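/- Let $\Lambda\subset\mathbb{C}$ be a lattice, $T=\mathbb{C}/\Lambda$, $N\ge 3$, and let $\alpha\in T$ be a point of exact order $N$. Write $\wp=\wp_\Lambda$ and $\omega_N=e^{2\pi i/N}$, let $r(z)=z+\alpha$ and $\mathbb{T}=T\setminus\{k\alpha : k\in\mathbb{Z}\}$, and let $\mathcal{O}_{\mathbb{T}}$ be the $\mathbb{C}$-algebra of meromorphic functions on $T$ that are holomorphic on $\mathbb{T}$. For $j\in\mathbb{Z}$ put $$P_j(z)=\sum_{k=0}^{N-1}\frac{\wp'(z-k\alpha)}{\omega_N^{kj}\,\bigl(\wp(z-k\alpha)-\wp(\alpha)\bigr)} .$$ Let $\Lambda_{(\alpha)}=\Lambda+\mathbb{Z}\alpha$ (the preimage in $\mathbb{C}$ of the subgroup of $T$ generated by $\alpha$), which is again a lattice, and $T'=\mathbb{C}/\Lambda_{(\alpha)}$. Then: 1. $\mathcal{O}_{\mathbb{T}}=\mathbb{C}[P_1,P_2,\ldots,P_{N-1}]$, that is, $\mathcal{O}_{\mathbb{T}}$ is the $\mathbb{C}$-algebra generated by $P_1,\ldots,P_{N-1}$. 2. For every integer $j\not\equiv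 0 \pmod N$, one has $\mathbb{C}[\wp_{\Lambda_{(\alpha)}}]=\mathbb{C}[P_{-j}P_j]$ as algebras of functions on $\mathbb{T}$. Moreover $P_{-j}P_j$ descends to a function on $T'\setminus\{0\}$, and as algebras of functions on $T'\setminus\{0\}$ one has $\mathbb{C}[\wp_{\Lambda_{(\alpha)}}]=\mathbb{C}[P_{-j}P_j]$, and both are equal to the algebra of even meromorphic functions on $T'$ that are holomorphic on $T'\setminus\{0\}$. -/

import Mathlib

noncomputable section

namespace PeriodPair

/-- The complex torus `T = ℂ / Λ`. -/
abbrev Torus (L : PeriodPair) : Type := ℂ ⧸ L.lattice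

/-- The torus with the set `S` removed. -/
abbrev Punctured (L : PeriodPair) (S : Set L.Torus) : Type := {x : L.Torus // x ∉ S}

/-- The function `℘_Λ` on `T = ℂ / Λ` (with a junk value at the pole `0`). -/
def torusP (L : PeriodPair) (x : L.Torus) : ℂ :=
  Quotient.liftOn' x L.weierstrassP (by
    intro a b h
    rw [Submodule.quotientRel_def] at h
    simpa using (L.weierstrassP_sub_coe a ⟨a - b, h⟩).symm)

@[simp] theorem torusP_mk (L : PeriodPair) (z : ℂ) :
    L.torusP (Submodule.Quotient.mk z) = L.weierstrassP z := rfl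

/-- The function `℘_Λ'` on `T = ℂ / Λ` (with a junk value at the pole `0`). -/
def torusP' (L : PeriodPair) (x : L.Torus) : ℂ :=
  Quotient.liftOn' x L.derivWeierstrassP (by
    intro a b h
    rw [Submodule.quotientRel_def] at h
    simpa using (L.derivWeierstrassP_sub_coe a ⟨a - b, h⟩).symm)

@[simp] theorem torusP'_mk (L : PeriodPair) (z : ℂ) :
    L.torusP' (Submodule.Quotient.mk z) = L.derivWeierstrassP z := rfl

/-- The `ℂ`-algebra of meromorphic functions on `T` that are holomorphic on `T \ S`
(intended for finite `S`). A meromorphic function on `T` is determined by its restriction to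
`T \ S`, so its elements are functions on `T \ S`: those whose pull-back along `ℂ → T` is
the restriction of a meromorphic function on `ℂ` that is analytic outside the preimage
of `S`. -/
def regularFunctions (L : PeriodPair) (S : Set L.Torus) : Subalgebra ℂ (L.Punctured S → ℂ) where
  carrier := {f | ∃ F : ℂ → ℂ, Meromorphic F ∧
    ∀ (z : ℂ) (hz : (Submodule.Quotient.mk z : L.Torus) ∉ S),
      AnalyticAt ℂ F z ∧ F z = f ⟨Submodule.Quotient.mk z, hz⟩}
  mul_mem' := by
    rintro f g ⟨F, hF, hF'⟩ ⟨G, hG, hG'⟩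
    exact ⟨F * G, hF.mul hG, fun z hz =>
      ⟨(hF' z hz).1.mul (hG' z hz).1, by simp [(hF' z hz).2, (hG' z hz).2]⟩⟩
  add_mem' := by
    rintro f g ⟨F, hF, hF'⟩ ⟨G, hG, hG'⟩
    exact ⟨F + G, hF.add hG, fun z hz =>
      ⟨(hF' z hz).1.add (hG' z hz).1, by simp [(hF' z hz).2, (hG' z hz).2]⟩⟩
  algebraMap_mem' := fun c =>
    ⟨fun _ => c, fun _ => analyticAt_const.meromorphicAt, fun _ _ => ⟨analyticAt_const, rfl⟩⟩

/-- The even functions in `L.regularFunctions S`. -/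
def evenRegularFunctions (L : PeriodPair) (S : Set L.Torus) :
    Subalgebra ℂ (L.Punctured S → ℂ) where
  carrier := {f | f ∈ L.regularFunctions S ∧
    ∀ (x : L.Torus) (hx : x ∉ S) (hx' : -x ∉ S), f ⟨-x, hx'⟩ = f ⟨x, hx⟩}
  mul_mem' := fun hf hg =>
    ⟨mul_mem hf.1 hg.1, fun x hx hx' => by simp [hf.2 x hx hx', hg.2 x hx hx']⟩
  add_mem' := fun hf hg =>
    ⟨add_mem hf.1 hg.1, fun x hx hx' => by simp [hf.2 x hx hx', hg.2 x hx hx']⟩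
  algebraMap_mem' := fun c => ⟨Subalgebra.algebraMap_mem _ c, fun _ _ _ => rfl⟩

/-- The orbit `{kα : k ∈ ℤ}` of `0` under the group generated by `r(z) = z + α`. -/
def orbit (L : PeriodPair) (α : L.Torus) : Set L.Torus := (AddSubgroup.zmultiples α : Set L.Torus)

/-- The function `P_j = ∑_{k=0}^{N-1} (r^k ℘') / (ω_N^{kj} r^k (℘ - ℘(α)))` on the torus punctured
at the multiples of `α`, where `r^k f (x) = f (x - kα)` and `ω_N = exp (2πi/N)`. -/
def projP (L : PeriodPair) (N : ℕ) (α : L.Torus) (j : ℤ) : L.Punctured (L.orbit α) → ℂ :=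
  fun x => ∑ k ∈ Finset.range N,
    L.torusP' (x.1 - k • α) /
      (Complex.exp (2 * Real.pi * Complex.I / N) ^ ((k : ℤ) * j) *
        (L.torusP (x.1 - k • α) - L.torusP α))

/-- The lattice `Λ_(α) = Λ + ℤα`, as the preimage in `ℂ` of the subgroup of `ℂ / Λ` generated
by `α`. -/
def torsionLattice (L : PeriodPair) (α : L.Torus) : Submodule ℤ ℂ :=
  (Submodule.span ℤ {α}).comap L.lattice.mkQ

theorem torsionLattice_mk (L : PeriodPair) (a : ℂ) :
    L.torsionLattice (Submodule.Quotient.mk a) = Submodule.span ℤ {L.ω₁, a, L.ω₂} := by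
  have : (Submodule.span ℤ {(Submodule.Quotient.mk a : L.Torus)}) =
      (Submodule.span ℤ {a}).map L.lattice.mkQ := by
    rw [Submodule.map_span]; simp
  rw [torsionLattice, this, Submodule.comap_map_mkQ, lattice, ← Submodule.span_union]
  congr 1
  ext x; simp; tauto

theorem lattice_le_torsionLattice (L : PeriodPair) (α : L.Torus) :
    L.lattice ≤ L.torsionLattice α := by
  intro z hz
  have : L.lattice.mkQ z = 0 := by simpa using hz
  simp [torsionLattice, this]

theorem mem_torsionLattice_iff (L : PeriodPair) (α : L.Torus) (z : ℂ) :
    z ∈ L.torsionLattice α ↔ (Submodule.Quotient.mk z : L.Torus) ∈ L.orbit α := by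
  simp [torsionLattice, orbit, Submodule.mem_span_singleton, AddSubgroup.mem_zmultiples_iff]

/-- For a torsion point `α`, the group `Λ_(α)` is again the lattice of a pair of periods. -/
theorem exists_lattice_eq_torsionLattice (L : PeriodPair) (α : L.Torus)
    (hα : IsOfFinAddOrder α) : ∃ L' : PeriodPair, L'.lattice = L.torsionLattice α := by
  obtain ⟨n, hn, hnα⟩ := isOfFinAddOrder_iff_nsmul_eq_zero.1 hα
  have hn0 : (n : ℂ) ≠ 0 := by exact_mod_cast hn.ne'
  have hmul : ∀ z ∈ L.torsionLattice α, (n : ℂ) * z ∈ L.lattice := by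
    intro z hz
    obtain ⟨k, hk⟩ := Submodule.mem_span_singleton.1 (show L.lattice.mkQ z ∈ _ from hz)
    have : L.lattice.mkQ (n • z) = 0 := by
      rw [map_nsmul, ← hk, smul_comm, hnα, smul_zero]
    simpa using this
  have hdisc : DiscreteTopology (L.torsionLattice α) := by
    let g : L.torsionLattice α → L.lattice := fun z => ⟨n * z.1, hmul z.1 z.2⟩
    refine DiscreteTopology.of_continuous_injective (f := g) ?_ ?_
    · exact Continuous.subtype_mk (by fun_prop) _
    · intro x y hxy
      have : (n : ℂ) * x.1 = n * y.1 := congrArg Subtype.val hxy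
      exact Subtype.ext (mul_left_cancel₀ hn0 this)
  have hlat : IsZLattice ℝ (L.torsionLattice α) := by
    constructor
    have htop : Submodule.span ℝ (L.lattice : Set ℂ) = ⊤ := IsZLattice.span_top
    rw [eq_top_iff, ← htop]
    exact Submodule.span_mono (L.lattice_le_torsionLattice α)
  have hfree : Module.Free ℤ (L.torsionLattice α) := ZLattice.module_free ℝ _
  have hfin : Module.Finite ℤ (L.torsionLattice α) := ZLattice.module_finite ℝ _
  have hrank : Module.finrank ℤ (L.torsionLattice α) = 2 := by
    rw [ZLattice.rank ℝ]; simp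
  let b := Module.finBasisOfFinrankEq ℤ (L.torsionLattice α) hrank
  let B := b.ofZLatticeBasis ℝ (L.torsionLattice α)
  have hB : ∀ i, B i = (b i : ℂ) := fun i => b.ofZLatticeBasis_apply ℝ _ i
  have hind : LinearIndependent ℝ ![(b 0 : ℂ), (b 1 : ℂ)] := by
    have hBb : ![(b 0 : ℂ), (b 1 : ℂ)] = B := by
      funext i
      rw [hB]
      revert i
      exact Fin.forall_fin_two.2 ⟨rfl, rfl⟩
    rw [hBb]
    exact B.linearIndependent
  have hset : ({(b 0 : ℂ), (b 1 : ℂ)} : Set ℂ) = Set.range B := by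
    ext x
    simp [hB, Fin.exists_fin_two, eq_comm]
  refine ⟨⟨b 0, b 1, hind⟩, ?_⟩
  change Submodule.span ℤ {(b 0 : ℂ), (b 1 : ℂ)} = _
  rw [hset]
  exact b.ofZLatticeBasis_span ℝ (L.torsionLattice α)

/-- The canonical projection `T = ℂ / Λ → T' = ℂ / Λ_(α)`. -/
def torsionProj (L : PeriodPair) {L' : PeriodPair} {α : L.Torus}
    (h : L'.lattice = L.torsionLattice α) : L.Torus →ₗ[ℤ] L'.Torus :=
  Submodule.factor (h ▸ L.lattice_le_torsionLattice α)

theorem torsionProj_ne_zero (L : PeriodPair) {L' : PeriodPair} {α : L.Torus}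
    (h : L'.lattice = L.torsionLattice α) (x : L.Torus) (hx : x ∉ L.orbit α) :
    L.torsionProj h x ∉ ({0} : Set L'.Torus) := by
  obtain ⟨z, rfl⟩ := Submodule.Quotient.mk_surjective _ x
  intro h0
  apply hx
  rw [← mem_torsionLattice_iff, ← h]
  exact (Submodule.Quotient.mk_eq_zero _).1 h0

/-- The canonical projection `T \ ⟨r⟩·{0} → T' \ {0}`. -/
def puncturedProj (L : PeriodPair) {L' : PeriodPair} {α : L.Torus}
    (h : L'.lattice = L.torsionLattice α) (x : L.Punctured (L.orbit α)) :
    L'.Punctured {0} :=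
  ⟨L.torsionProj h x.1, L.torsionProj_ne_zero h x.1 x.2⟩

/-- `℘_Λ` as a function on `T \ {0}`. -/
def puncturedP (L : PeriodPair) : L.Punctured {0} → ℂ := fun x => L.torusP x.1

end PeriodPair

end

noncomputable section

open Filter Topology

/-! An algebra of elliptic functions with prescribed poles is determined by the leading coefficients
it realises: subtract a known function with the same leading coefficients, lower the pole order, and
end at a function without poles, constant by Liouville (`le_of_forall_leadingCoeff`).

Part 1. The function `℘'/(℘ - ℘(α))` has simple poles with residue `-2` at `0` and `1` at `±α`,
distinct points since `N ≥ 3`. Hence `P_j` has residue `(ω^j + ω^(-j) - 2) ω^(-mj)` at `mα`: a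
multiple of a character of `ℤ/N`, nonzero unless `N ∣ j`. Leading coefficients along the orbit form
an `N`-periodic sequence, that is, a combination of characters. For a simple pole the residue
theorem excludes the trivial character. For order at least `2` every character is a product of
nontrivial ones, again because `N ≥ 3`, so products of the `P_j` suffice
(`exists_mem_projAlgebra_hasLeadingCoeffAt`).

Part 2. In `P_{-j} P_j` the two characters cancel, and `P_j(-z) = -P_{-j}(z)`; the product is
therefore an even function on `T'` with a double pole at `0` only. An even function has only even
leading orders at `0`, so the powers of any such function realise them all
(`adjoin_eq_evenRegularFunctions`). This applies equally to `℘` of `Λ_(α)`. -/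

theorem tendsto_add_const_nhdsNE (p l : ℂ) : Tendsto (fun z => z + l) (𝓝[≠] p) (𝓝[≠] (p + l)) := by
  refine tendsto_nhdsWithin_iff.2 ⟨Tendsto.mono_left ?_ nhdsWithin_le_nhds, ?_⟩
  · exact (continuous_id.add continuous_const).tendsto p
  · filter_upwards [self_mem_nhdsWithin] with z hz
    simpa using hz

theorem tendsto_neg_nhdsNE (p : ℂ) : Tendsto (fun z => -z) (𝓝[≠] p) (𝓝[≠] (-p)) := by
  refine tendsto_nhdsWithin_iff.2 ⟨Tendsto.mono_left ?_ nhdsWithin_le_nhds, ?_⟩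
  · exact continuous_neg.tendsto p
  · filter_upwards [self_mem_nhdsWithin] with z hz
    simpa using hz

/-- Identity theorem: finiteness of the order propagates through the connected plane. -/
theorem Meromorphic.eventually_ne_zero {F : ℂ → ℂ} (hF : Meromorphic F) {p : ℂ}
    (hp : ∀ᶠ z in 𝓝[≠] p, F z ≠ 0) (q : ℂ) : ∀ᶠ z in 𝓝[≠] q, F z ≠ 0 := by
  rw [← meromorphicOrderAt_ne_top_iff_eventually_ne_zero (hF q)]
  exact hF.exists_meromorphicOrderAt_ne_top_iff_forall.1
    ⟨p, (meromorphicOrderAt_ne_top_iff_eventually_ne_zero (hF p)).2 hp⟩ q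

theorem Meromorphic.comp_add_const {F : ℂ → ℂ} (hF : Meromorphic F) (c : ℂ) :
    Meromorphic fun z => F (z + c) := fun p =>
  (hF (p + c)).comp_analyticAt (f := F) (g := fun z => z + c) (by fun_prop)

theorem Meromorphic.comp_neg {F : ℂ → ℂ} (hF : Meromorphic F) : Meromorphic fun z => F (-z) :=
  fun p => (hF (-p)).comp_analyticAt (f := F) (g := fun z => -z) (by fun_prop)

/-! ### Liouville's theorem and a residue theorem for elliptic functions -/

namespace PeriodPair

/-- **Liouville's theorem** for elliptic functions: a meromorphic function without poles which is
periodic with respect to a lattice is constant. -/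
theorem exists_eq_of_periodic_of_tendsto (L : PeriodPair) {F : ℂ → ℂ} (hF : Meromorphic F)
    (hper : ∀ l ∈ L.lattice, ∀ z, F (z + l) = F z)
    (hlim : ∀ p, ∃ c, Tendsto F (𝓝[≠] p) (𝓝 c)) :
    ∃ c, ∀ z, ContinuousAt F z → F z = c := by
  -- `G` is `F` with its removable singularities filled in. It is continuous and agrees with `F` off
  -- a discrete set, so it is entire by Riemann's theorem, and bounded by periodicity.
  choose G hG using hlim
  have hFG : ∀ z, ContinuousAt F z → F z = G z := fun z hz =>
    tendsto_nhds_unique (hz.tendsto.mono_left nhdsWithin_le_nhds) (hG z)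
  have hev : ∀ p, ∀ᶠ z in 𝓝[≠] p, F z = G z := fun p => by
    filter_upwards [(hF p).eventually_analyticAt] with z hz using hFG z hz.continuousAt
  have hcont : ∀ p, ContinuousAt G p := fun p =>
    continuousAt_iff_punctured_nhds.2 ((hG p).congr' (hev p))
  have hdiff : Differentiable ℂ G := fun p => by
    refine (Complex.analyticAt_of_differentiable_on_punctured_nhds_of_continuousAt ?_
      (hcont p)).differentiableAt
    filter_upwards [eventually_eventually_nhdsWithin.2 (hev p), (hF p).eventually_analyticAt]
      with z hz hz'
    refine hz'.differentiableAt.congr_of_eventuallyEq (EventuallyEq.symm ?_)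
    exact (hz'.continuousAt.eventuallyEq_nhds_iff_eventuallyEq_nhdsNE (hcont z)).1
      ((hev z))
  have hGper : ∀ z l, l ∈ L.lattice → G (z + l) = G z := fun z l hl => by
    refine tendsto_nhds_unique ((hG (z + l)).comp (tendsto_add_const_nhdsNE z l)) ?_
    simpa [Function.comp_def, hper l hl] using hG z
  have hb := (IsZLattice.isCompact_range_of_periodic L.lattice G hdiff.continuous hGper).isBounded
  exact ⟨G 0, fun z hz => (hFG z hz).trans (hdiff.apply_eq_apply_of_bounded hb z 0)⟩

/-- An elliptic function with at most a simple pole at the lattice points, and no other pole, has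
no pole at all. -/
theorem residue_eq_zero (L : PeriodPair) {F : ℂ → ℂ} (hF : Meromorphic F)
    (hper : ∀ l ∈ L.lattice, ∀ z, F (z + l) = F z) (han : ∀ z ∉ L.lattice, AnalyticAt ℂ F z)
    {c : ℂ} (hc : Tendsto (fun z => z * F z) (𝓝[≠] 0) (𝓝 c)) : c = 0 := by
  by_contra hc0
  -- No contour integral is used. The odd part doubles the residue, and an odd elliptic function is
  -- zero at half-periods outside the lattice.
  set G : ℂ → ℂ := fun z => F z - F (-z) with hGdef
  have hGm : Meromorphic G := hF.sub hF.comp_neg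
  have hGper : ∀ l ∈ L.lattice, ∀ z, G (z + l) = G z := fun l hl z => by
    simp only [hGdef, neg_add, hper l hl, hper (-l) (neg_mem hl)]
  have hGan : ∀ z ∉ L.lattice, AnalyticAt ℂ G z := fun z hz =>
    (han z hz).sub (AnalyticAt.comp (g := F) (han (-z) (by simpa using hz)) (by fun_prop))
  have hGodd : ∀ z, G (-z) = -G z := fun z => by simp [hGdef]
  have hGc : Tendsto (fun z => z * G z) (𝓝[≠] 0) (𝓝 (c + c)) := by
    have := (hc.comp (by simpa using tendsto_neg_nhdsNE 0)).add hc
    refine this.congr fun z => ?_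
    simp [hGdef]; ring
  have hGhalf : ∀ z, z + z ∈ L.lattice → G z = 0 := fun z hz => by
    have h1 := hGper _ hz (-z)
    rw [neg_add_cancel_left, hGodd] at h1
    exact self_eq_neg.1 h1
  set w := L.ω₁ / 2 with hw
  have hww : w + w = L.ω₁ := by rw [hw]; ring
  have hwL : w ∉ L.lattice := L.ω₁_div_two_notMem_lattice
  -- The zero of `G` at the half-period `w` cancels its simple pole at `0`, so `H` has no poles and
  -- is constant. It vanishes at the other half-period `ω₂ / 2`, although `G` is not identically
  -- zero.
  set H : ℂ → ℂ := fun z => G z * G (z + w) with hHdef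
  have hHm : Meromorphic H := hGm.mul (hGm.comp_add_const w)
  have hHper : ∀ l ∈ L.lattice, ∀ z, H (z + l) = H z := fun l hl z => by
    simp only [hHdef, hGper l hl, add_right_comm z l w]
  have hHw : ∀ z, H (z + w) = H z := fun z => by
    simp only [hHdef, add_assoc, hww, hGper _ L.ω₁_mem_lattice]
    ring
  have hHan : ∀ z, z ∉ L.lattice → z + w ∉ L.lattice → AnalyticAt ℂ H z := fun z h1 h2 =>
    (hGan z h1).mul (AnalyticAt.comp (g := G) (hGan _ h2) (by fun_prop))
  have hH0 : Tendsto H (𝓝[≠] 0) (𝓝 ((c + c) * deriv G w)) := by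
    have h1 := ((hGan w hwL).differentiableAt.hasDerivAt).tendsto_slope_zero
    refine (hGc.mul h1).congr' ?_
    filter_upwards [self_mem_nhdsWithin] with z hz
    have hz' : z ≠ 0 := hz
    simp only [hHdef, hGhalf w (hww ▸ L.ω₁_mem_lattice), smul_eq_mul, add_comm w z]
    field_simp
    ring
  have shift : ∀ (p l : ℂ), (∀ z, H (z + l) = H z) → p - l = 0 →
      Tendsto H (𝓝[≠] p) (𝓝 ((c + c) * deriv G w)) := fun p l hl hp => by
    have h1 := tendsto_add_const_nhdsNE p (-l)
    rw [← sub_eq_add_neg, hp] at h1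
    refine (hH0.comp h1).congr fun z => ?_
    rw [Function.comp, ← hl (z + -l), neg_add_cancel_right]
  have hlim : ∀ p, ∃ d, Tendsto H (𝓝[≠] p) (𝓝 d) := fun p => by
    by_cases h1 : p ∈ L.lattice
    · exact ⟨_, shift p p (hHper p h1) (sub_self p)⟩
    by_cases h2 : p + w ∈ L.lattice
    · refine ⟨_, shift p p (fun z => ?_) (sub_self p)⟩
      rw [← hHw, add_assoc, hHper _ h2]
    · exact ⟨_, (hHan p h1 h2).continuousAt.tendsto.mono_left nhdsWithin_le_nhds⟩
  obtain ⟨d, hd⟩ := L.exists_eq_of_periodic_of_tendsto hHm hHper hlim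
  have hd0 : d = 0 := by
    rw [← hd (L.ω₂ / 2)]
    · have : G (L.ω₂ / 2) = 0 := hGhalf _ (by simpa using L.ω₂_mem_lattice)
      simp [hHdef, this]
    · refine (hHan _ L.ω₂_div_two_notMem_lattice fun h => ?_).continuousAt
      have := (L.mul_ω₁_add_mul_ω₂_mem_lattice (α := 1 / 2) (β := 1 / 2)).1
        (by convert! h using 1; push_cast; ring)
      exact absurd this.1 (by simp)
  have hG0 : ∀ᶠ z in 𝓝[≠] (0 : ℂ), G z ≠ 0 := by
    have h2 : c + c ≠ 0 := by simpa using hc0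
    filter_upwards [hGc.eventually_ne h2] with z hz h
    simp [h] at hz
  have hG1 : ∀ᶠ z in 𝓝[≠] (0 : ℂ), G (z + w) ≠ 0 :=
    (tendsto_add_const_nhdsNE 0 w).eventually (hGm.eventually_ne_zero hG0 _)
  obtain ⟨z, h1, h2, h3⟩ := (hG0.and (hG1.and (hHm 0).eventually_analyticAt)).exists
  exact mul_ne_zero h1 h2 ((hd z h3.continuousAt).trans hd0)

/-! ### Poles of `℘` and `℘'`, and the points where `℘` takes equal values -/

theorem analyticAt_weierstrassP (L : PeriodPair) {z : ℂ} (hz : z ∉ L.lattice) :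
    AnalyticAt ℂ L.weierstrassP z := L.analyticOnNhd_weierstrassP z hz

theorem analyticAt_derivWeierstrassP (L : PeriodPair) {z : ℂ} (hz : z ∉ L.lattice) :
    AnalyticAt ℂ L.derivWeierstrassP z := L.analyticOnNhd_derivWeierstrassP z hz

theorem hasDerivAt_weierstrassP (L : PeriodPair) {z : ℂ} (hz : z ∉ L.lattice) :
    HasDerivAt L.weierstrassP (L.derivWeierstrassP z) z := by
  rw [← L.deriv_weierstrassP]
  exact (L.analyticAt_weierstrassP hz).differentiableAt.hasDerivAt

theorem tendsto_sq_mul_weierstrassP (L : PeriodPair) :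
    Tendsto (fun z => z ^ 2 * L.weierstrassP z) (𝓝[≠] 0) (𝓝 1) := by
  have h := L.analyticAt_weierstrassPExcept 0
  have h1 : ContinuousAt (fun z => z ^ 2 * L.weierstrassPExcept 0 z + 1) 0 :=
    (((continuous_pow 2).continuousAt).mul h.continuousAt).add continuousAt_const
  have h2 := h1.tendsto.mono_left (nhdsWithin_le_nhds (s := {(0 : ℂ)}ᶜ))
  simp only [ne_eq, OfNat.ofNat_ne_zero, not_false_eq_true, zero_pow, zero_mul, zero_add] at h2
  refine h2.congr' ?_
  filter_upwards [self_mem_nhdsWithin] with z hz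
  have hz' : z ≠ 0 := hz
  have := L.ite_eq_one_sub_sq_mul_weierstrassP 0 (zero_mem _) z
  simp only [hz', if_false, sub_zero] at this
  rw [this]; simp

theorem tendsto_cube_mul_derivWeierstrassP (L : PeriodPair) :
    Tendsto (fun z => z ^ 3 * L.derivWeierstrassP z) (𝓝[≠] 0) (𝓝 (-2)) := by
  have h := L.analyticAt_derivWeierstrassPExcept 0
  have h1 : ContinuousAt (fun z => z ^ 3 * L.derivWeierstrassPExcept 0 z - 2) 0 :=
    (((continuous_pow 3).continuousAt).mul h.continuousAt).sub continuousAt_const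
  have h2 := h1.tendsto.mono_left (nhdsWithin_le_nhds (s := {(0 : ℂ)}ᶜ))
  simp only [ne_eq, OfNat.ofNat_ne_zero, not_false_eq_true, zero_pow, zero_mul, zero_sub] at h2
  refine h2.congr' ?_
  filter_upwards [self_mem_nhdsWithin] with z hz
  have hz' : z ≠ 0 := hz
  have := L.derivWeierstrassPExcept_def 0 z
  simp only [ZeroMemClass.coe_zero, sub_zero] at this
  rw [this]; field_simp; ring

theorem eventually_derivWeierstrassP_ne_zero (L : PeriodPair) (p : ℂ) :
    ∀ᶠ z in 𝓝[≠] p, L.derivWeierstrassP z ≠ 0 := by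
  refine L.meromorphic_derivWeierstrassP.eventually_ne_zero (p := 0) ?_ p
  filter_upwards [L.tendsto_cube_mul_derivWeierstrassP.eventually_ne (by norm_num : (-2 : ℂ) ≠ 0)]
    with z hz h
  simp [h] at hz

theorem eventually_notMem_lattice (L : PeriodPair) (p : ℂ) : ∀ᶠ z in 𝓝[≠] p, z ∉ L.lattice := by
  filter_upwards [nhdsWithin_le_nhds (L.compl_lattice_sdiff_singleton_mem_nhds p),
    self_mem_nhdsWithin] with z hz hzp h using hz ⟨h, hzp⟩

/-- Differentiate the cubic equation for `℘'` and divide by `2℘'`; the zeros of `℘'` are isolated,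
so continuity covers them. -/
theorem deriv_derivWeierstrassP (L : PeriodPair) {z : ℂ} (hz : z ∉ L.lattice) :
    deriv L.derivWeierstrassP z = 6 * L.weierstrassP z ^ 2 - L.g₂ / 2 := by
  have hopen : ∀ y ∉ L.lattice, ∀ᶠ x in 𝓝 y, x ∉ L.lattice := fun y hy =>
    L.isClosed_lattice.isOpen_compl.mem_nhds hy
  have key : ∀ y ∉ L.lattice, L.derivWeierstrassP y ≠ 0 →
      deriv L.derivWeierstrassP y = 6 * L.weierstrassP y ^ 2 - L.g₂ / 2 := fun y hy hy0 => by
    have h1 : (fun x => L.derivWeierstrassP x ^ 2) =ᶠ[𝓝 y]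
        fun x => 4 * L.weierstrassP x ^ 3 - L.g₂ * L.weierstrassP x - L.g₃ := by
      filter_upwards [hopen y hy] with x hx using L.derivWeierstrassP_sq x hx
    have hP := L.hasDerivAt_weierstrassP hy
    have h2 := ((L.analyticAt_derivWeierstrassP hy).differentiableAt.hasDerivAt.fun_pow 2)
    have h3 := (((hP.fun_pow 3).const_mul 4).sub (hP.const_mul L.g₂)).sub_const L.g₃
    have h4 := (h2.congr_of_eventuallyEq h1.symm).unique h3
    have h5 : L.derivWeierstrassP y * (deriv L.derivWeierstrassP y -
        (6 * L.weierstrassP y ^ 2 - L.g₂ / 2)) = 0 := by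
      push_cast at h4
      linear_combination h4 / 2
    exact sub_eq_zero.1 ((mul_eq_zero.1 h5).resolve_left hy0)
  have hA := L.analyticAt_weierstrassP hz
  have hB := (L.analyticAt_derivWeierstrassP hz).deriv
  have hev : deriv L.derivWeierstrassP =ᶠ[𝓝[≠] z]
      fun x => 6 * L.weierstrassP x ^ 2 - L.g₂ / 2 := by
    filter_upwards [L.eventually_derivWeierstrassP_ne_zero z, L.eventually_notMem_lattice z]
      with x h1 h2 using key x h2 h1
  exact ((hB.continuousAt.eventuallyEq_nhds_iff_eventuallyEq_nhdsNE
    (by fun_prop)).1 hev).eq_of_nhds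

/-- The pair `(℘, ℘')` separates the points of the punctured torus. -/
theorem sub_mem_lattice_of_eq_of_deriv_eq (L : PeriodPair) {a b : ℂ} (ha : a ∉ L.lattice)
    (hb : b ∉ L.lattice) (h0 : L.weierstrassP a = L.weierstrassP b)
    (h1 : L.derivWeierstrassP a = L.derivWeierstrassP b) : a - b ∈ L.lattice := by
  by_contra hab
  have shiftan : ∀ {f : ℂ → ℂ} (c : ℂ), AnalyticAt ℂ f c → AnalyticAt ℂ (fun z => f (z + c)) 0 :=
    fun {f} c hf => AnalyticAt.comp (g := f) (by simpa using hf) (by fun_prop)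
  -- By the second-order equation for `℘`, the difference `D` solves the linear equation `D'' = S D`
  -- near `0` with `D(0) = D'(0) = 0`.
  set D : ℂ → ℂ := fun z => L.weierstrassP (z + a) - L.weierstrassP (z + b)
  set D1 : ℂ → ℂ := fun z => L.derivWeierstrassP (z + a) - L.derivWeierstrassP (z + b)
  set S : ℂ → ℂ := fun z => 6 * (L.weierstrassP (z + a) + L.weierstrassP (z + b))
  have hDm : Meromorphic D :=
    (L.meromorphic_weierstrassP.comp_add_const a).sub (L.meromorphic_weierstrassP.comp_add_const b)
  have hDa : AnalyticAt ℂ D 0 := (shiftan a (L.analyticAt_weierstrassP ha)).sub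
    (shiftan b (L.analyticAt_weierstrassP hb))
  have hD1a : AnalyticAt ℂ D1 0 := (shiftan a (L.analyticAt_derivWeierstrassP ha)).sub
    (shiftan b (L.analyticAt_derivWeierstrassP hb))
  have hSa : AnalyticAt ℂ S 0 := analyticAt_const.mul
    ((shiftan a (L.analyticAt_weierstrassP ha)).add (shiftan b (L.analyticAt_weierstrassP hb)))
  have hoff : ∀ c ∉ L.lattice, ∀ᶠ z in 𝓝 (0 : ℂ), z + c ∉ L.lattice := fun c hc =>
    (L.isClosed_lattice.preimage (continuous_id.add continuous_const)).isOpen_compl.mem_nhds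
      (by simpa using hc)
  have hdD : deriv D =ᶠ[𝓝[≠] 0] D1 := by
    refine EventuallyEq.filter_mono ?_ nhdsWithin_le_nhds
    filter_upwards [hoff a ha, hoff b hb] with z hza hzb
    exact (((L.hasDerivAt_weierstrassP hza).comp_add_const z a).sub
      ((L.hasDerivAt_weierstrassP hzb).comp_add_const z b)).deriv
  have hdD1 : deriv D1 =ᶠ[𝓝[≠] 0] fun z => S z * D z := by
    refine EventuallyEq.filter_mono ?_ nhdsWithin_le_nhds
    filter_upwards [hoff a ha, hoff b hb] with z hza hzb
    have h2 := ((L.analyticAt_derivWeierstrassP hza).differentiableAt.hasDerivAt).comp_add_const z a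
    have h3 := ((L.analyticAt_derivWeierstrassP hzb).differentiableAt.hasDerivAt).comp_add_const z b
    rw [show deriv D1 z = _ from (h2.sub h3).deriv, L.deriv_derivWeierstrassP hza,
      L.deriv_derivWeierstrassP hzb]
    ring
  have hDpos : 0 < meromorphicOrderAt D 0 :=
    (tendsto_zero_iff_meromorphicOrderAt_pos (hDm 0)).1
      (by simpa [D, h0] using hDa.continuousAt.tendsto.mono_left nhdsWithin_le_nhds)
  have hD1pos : 0 < meromorphicOrderAt D1 0 :=
    (tendsto_zero_iff_meromorphicOrderAt_pos hD1a.meromorphicAt).1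
      (by simpa [D1, h1] using hD1a.continuousAt.tendsto.mono_left nhdsWithin_le_nhds)
  -- A finite order `n` would give `D''` order `n - 2`, while `S D` has order at least `n`.
  have htop : meromorphicOrderAt D 0 = ⊤ := by
    by_contra hne
    obtain ⟨n, hn⟩ := WithTop.ne_top_iff_exists.1 hne
    have hn0 : 0 < n := by rw [← hn] at hDpos; exact_mod_cast hDpos
    have h2 := meromorphicOrderAt_deriv_eq_sub_one (by exact_mod_cast hn0.ne') hn.symm
    rw [meromorphicOrderAt_congr hdD] at h2
    have hn1 : 0 < n - 1 := by rw [h2] at hD1pos; exact_mod_cast hD1pos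
    have h3 := meromorphicOrderAt_deriv_eq_sub_one (by exact_mod_cast hn1.ne') h2
    rw [meromorphicOrderAt_congr hdD1, ← Pi.mul_def,
      meromorphicOrderAt_mul hSa.meromorphicAt (hDm 0), ← hn] at h3
    have h4 : ((n : ℤ) : WithTop ℤ) ≤ ((n - 1 - 1 : ℤ) : WithTop ℤ) := by
      rw [← h3]
      exact le_add_of_nonneg_left hSa.meromorphicOrderAt_nonneg
    have h5 : n ≤ n - 1 - 1 := by exact_mod_cast h4
    omega
  -- Now `D` vanishes identically, but at `-a` the term `℘(z + a)` has a pole and `℘(z + b)` stays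
  -- finite.
  have hcob : Tendsto L.weierstrassP (𝓝[≠] 0) (Bornology.cobounded ℂ) :=
    tendsto_cobounded_of_meromorphicOrderAt_neg
      (by rw [L.order_weierstrassP 0 (zero_mem _)]; decide)
  have hcob' := hcob.comp (by simpa using tendsto_add_const_nhdsNE (-a) a)
  have heq : ∀ᶠ z in 𝓝[≠] (-a), D z = 0 := by
    rw [← meromorphicOrderAt_eq_top_iff]
    by_contra h
    exact hDm.exists_meromorphicOrderAt_ne_top_iff_forall.1 ⟨-a, h⟩ 0 htop
  have hba : -a + b ∉ L.lattice := fun h => hab (by simpa [neg_add_eq_sub] using neg_mem h)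
  have hfin : Tendsto (fun z => L.weierstrassP (z + b)) (𝓝[≠] (-a))
      (𝓝 (L.weierstrassP (-a + b))) :=
    ((L.analyticAt_weierstrassP hba).continuousAt.tendsto.comp
      ((tendsto_add_const_nhdsNE (-a) b).mono_right nhdsWithin_le_nhds))
  refine not_tendsto_nhds_of_tendsto_atTop (tendsto_norm_cobounded_atTop.comp hcob') _
    ((hfin.congr' ?_).norm)
  filter_upwards [heq] with z hz using (sub_eq_zero.1 hz).symm

/-- The cubic equation determines `℘'` up to sign from `℘`; the sign is absorbed by replacing `b`
with `-b`. -/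
theorem weierstrassP_eq_iff (L : PeriodPair) {a b : ℂ} (ha : a ∉ L.lattice) (hb : b ∉ L.lattice) :
    L.weierstrassP a = L.weierstrassP b ↔ a - b ∈ L.lattice ∨ a + b ∈ L.lattice := by
  constructor
  · intro h
    have h2 : L.derivWeierstrassP a ^ 2 = L.derivWeierstrassP b ^ 2 := by
      rw [L.derivWeierstrassP_sq a ha, L.derivWeierstrassP_sq b hb, h]
    rcases sq_eq_sq_iff_eq_or_eq_neg.1 h2 with h3 | h3
    · exact Or.inl (L.sub_mem_lattice_of_eq_of_deriv_eq ha hb h h3)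
    · right
      simpa using L.sub_mem_lattice_of_eq_of_deriv_eq ha (b := -b) (by simpa using hb)
        (by simpa using h) (by simpa using h3)
  · rintro (h | h)
    · simpa using L.weierstrassP_add_coe b ⟨a - b, h⟩
    · simpa using L.weierstrassP_add_coe (-b) ⟨a + b, h⟩

/-- At a zero of `℘'` the pair `(℘, ℘')` would not separate `a` from `-a`. -/
theorem derivWeierstrassP_ne_zero (L : PeriodPair) {a : ℂ} (ha : a + a ∉ L.lattice) :
    L.derivWeierstrassP a ≠ 0 := by
  intro h
  have haL : a ∉ L.lattice := fun h => ha (add_mem h h)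
  refine ha ?_
  simpa using L.sub_mem_lattice_of_eq_of_deriv_eq haL (b := -a) (by simpa using haL)
    (by simp) (by simp [h])

end PeriodPair

/-! ### Leading coefficients at poles -/

/-- `(z - p) ^ n * F z` tends to `c` as `z` tends to `p`: the function `F` has a pole of order at
most `n` at `p`, and `c` is its leading coefficient. -/
def HasLeadingCoeffAt (F : ℂ → ℂ) (n : ℕ) (p c : ℂ) : Prop :=
  Tendsto (fun z => (z - p) ^ n * F z) (𝓝[≠] p) (𝓝 c)

namespace HasLeadingCoeffAt

variable {F G : ℂ → ℂ} {n m : ℕ} {p c d : ℂ}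

theorem unique (hF : HasLeadingCoeffAt F n p c) (hG : HasLeadingCoeffAt F n p d) : c = d :=
  tendsto_nhds_unique hF hG

theorem congr (hF : HasLeadingCoeffAt F n p c) (h : F =ᶠ[𝓝[≠] p] G) :
    HasLeadingCoeffAt G n p c := by
  refine Tendsto.congr' ?_ hF
  filter_upwards [h] with z hz
  rw [hz]

theorem sub (hF : HasLeadingCoeffAt F n p c) (hG : HasLeadingCoeffAt G n p d) :
    HasLeadingCoeffAt (F - G) n p (c - d) :=
  (Tendsto.sub hF hG).congr fun z => by simp [mul_sub]

theorem mul (hF : HasLeadingCoeffAt F n p c) (hG : HasLeadingCoeffAt G m p d) :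
    HasLeadingCoeffAt (F * G) (n + m) p (c * d) :=
  (Tendsto.mul hF hG).congr fun z => by simp only [Pi.mul_apply]; ring

theorem const_smul (hF : HasLeadingCoeffAt F n p c) (a : ℂ) :
    HasLeadingCoeffAt (a • F) n p (a * c) :=
  (Tendsto.const_mul a hF).congr fun z => by simp only [Pi.smul_apply, smul_eq_mul]; ring

theorem pow (hF : HasLeadingCoeffAt F n p c) (k : ℕ) :
    HasLeadingCoeffAt (F ^ k) (n * k) p (c ^ k) :=
  (Tendsto.pow hF k).congr fun z => by simp only [Pi.pow_apply]; ring

theorem sum {ι : Type*} (s : Finset ι) {F : ι → ℂ → ℂ} {c : ι → ℂ}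
    (h : ∀ i ∈ s, HasLeadingCoeffAt (F i) n p (c i)) :
    HasLeadingCoeffAt (∑ i ∈ s, F i) n p (∑ i ∈ s, c i) :=
  (tendsto_finsetSum s h).congr fun z => by simp [Finset.mul_sum]

theorem of_continuousAt (hF : ContinuousAt F p) : HasLeadingCoeffAt F 0 p (F p) := by
  simpa [HasLeadingCoeffAt] using hF.tendsto.mono_left nhdsWithin_le_nhds

theorem zero_of_lt (hF : HasLeadingCoeffAt F n p c) (hnm : n < m) :
    HasLeadingCoeffAt F m p 0 := by
  have h1 : Tendsto (fun z : ℂ => (z - p) ^ (m - n)) (𝓝[≠] p) (𝓝 0) := by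
    have : Continuous fun z : ℂ => (z - p) ^ (m - n) := by fun_prop
    simpa [(Nat.sub_pos_of_lt hnm).ne'] using (this.tendsto p).mono_left nhdsWithin_le_nhds
  simpa [← mul_assoc, ← pow_add, Nat.sub_add_cancel hnm.le, HasLeadingCoeffAt] using h1.mul hF

theorem exists_of_le (hF : HasLeadingCoeffAt F n p c) (hnm : n ≤ m) :
    ∃ d, HasLeadingCoeffAt F m p d := by
  rcases hnm.eq_or_lt with rfl | h
  exacts [⟨c, hF⟩, ⟨0, hF.zero_of_lt h⟩]

theorem comp_add_const (hF : HasLeadingCoeffAt F n p c) {q l : ℂ} (hq : q + l = p) :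
    HasLeadingCoeffAt (fun z => F (z + l)) n q c := by
  have h := Tendsto.comp hF (hq ▸ tendsto_add_const_nhdsNE q l)
  exact h.congr fun z => by simp [← hq]

theorem comp_neg (hF : HasLeadingCoeffAt F n (-p) c) :
    HasLeadingCoeffAt (fun z => F (-z)) n p ((-1) ^ n * c) := by
  have h := (Tendsto.comp hF (tendsto_neg_nhdsNE p)).const_mul ((-1) ^ n)
  refine h.congr fun z => ?_
  rw [Function.comp, ← mul_assoc, ← mul_pow]
  ring_nf

/-- Orders of meromorphic functions are integers, so a vanishing coefficient lowers the pole order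
by at least one. -/
theorem exists_of_zero (hm : MeromorphicAt F p) (hF : HasLeadingCoeffAt F (n + 1) p 0) :
    ∃ d, HasLeadingCoeffAt F n p d := by
  have hm' : MeromorphicAt (fun z => (z - p) ^ n * F z) p := by fun_prop
  have h1 : MeromorphicAt (fun z => z - p) p := by fun_prop
  refine (tendsto_nhds_iff_meromorphicOrderAt_nonneg hm').2 ?_
  have h2 : 0 < meromorphicOrderAt ((fun z => z - p) * fun z => (z - p) ^ n * F z) p := by
    refine (tendsto_zero_iff_meromorphicOrderAt_pos (h1.mul hm')).1 (Tendsto.congr (fun z => ?_) hF)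
    simp only [Pi.mul_apply]; ring
  rw [meromorphicOrderAt_mul h1 hm', meromorphicOrderAt_id_sub_const] at h2
  cases h : meromorphicOrderAt (fun z => (z - p) ^ n * F z) p with
  | top => exact le_top
  | coe k =>
    rw [h] at h2
    have : 0 < 1 + k := by exact_mod_cast h2
    exact_mod_cast (by omega : 0 ≤ k)

end HasLeadingCoeffAt

theorem MeromorphicAt.exists_hasLeadingCoeffAt {F : ℂ → ℂ} {p : ℂ} (hF : MeromorphicAt F p) :
    ∃ n c, HasLeadingCoeffAt F n p c := by
  obtain ⟨n, hn⟩ := hF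
  exact ⟨n, _, hn.continuousAt.tendsto.mono_left nhdsWithin_le_nhds⟩

/-! ### Functions on a punctured torus and reduction of the pole order -/

namespace PeriodPair

theorem mk_add_of_mem (L : PeriodPair) {l : ℂ} (hl : l ∈ L.lattice) (z : ℂ) :
    (Submodule.Quotient.mk (z + l) : L.Torus) = Submodule.Quotient.mk z :=
  (Submodule.Quotient.eq _).2 (by simpa using hl)

theorem eventually_nhdsNE_mk_notMem (L : PeriodPair) {S : Set L.Torus} (hS : S.Finite) (p : ℂ) :
    ∀ᶠ z in 𝓝[≠] p, (Submodule.Quotient.mk z : L.Torus) ∉ S := by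
  have : ∀ x ∈ S, ∀ᶠ z in 𝓝[≠] p, (Submodule.Quotient.mk z : L.Torus) ≠ x := fun x _ => by
    obtain ⟨a, rfl⟩ := Submodule.Quotient.mk_surjective _ x
    filter_upwards [(tendsto_add_const_nhdsNE p (-a)).eventually (L.eventually_notMem_lattice _)]
      with z hz h
    exact hz (by simpa [← sub_eq_add_neg] using (Submodule.Quotient.eq _).1 h)
  filter_upwards [(hS.eventually_all).2 this] with z hz h using hz _ h rfl

theorem eventually_nhds_mk_notMem (L : PeriodPair) {S : Set L.Torus} (hS : S.Finite) {p : ℂ}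
    (hp : (Submodule.Quotient.mk p : L.Torus) ∉ S) :
    ∀ᶠ z in 𝓝 p, (Submodule.Quotient.mk z : L.Torus) ∉ S := by
  filter_upwards [insert_mem_nhds_iff.2 (L.eventually_nhdsNE_mk_notMem hS p)] with z hz
  rcases hz with rfl | hz
  exacts [hp, hz]

open Classical in
/-- The pull-back to `ℂ` of a function on a punctured torus, extended by `0`. -/
def pullback (L : PeriodPair) {S : Set L.Torus} (f : L.Punctured S → ℂ) (z : ℂ) : ℂ :=
  if hz : (Submodule.Quotient.mk z : L.Torus) ∉ S then f ⟨Submodule.Quotient.mk z, hz⟩ else 0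

section pullback

variable {L : PeriodPair} {S : Set L.Torus} (f g : L.Punctured S → ℂ)

theorem pullback_of_notMem {z : ℂ} (hz : (Submodule.Quotient.mk z : L.Torus) ∉ S) :
    L.pullback f z = f ⟨Submodule.Quotient.mk z, hz⟩ := dif_pos hz

theorem pullback_of_mem {z : ℂ} (hz : (Submodule.Quotient.mk z : L.Torus) ∈ S) :
    L.pullback f z = 0 := dif_neg (not_not.2 hz)

theorem pullback_mul : L.pullback (f * g) = L.pullback f * L.pullback g := by
  funext z
  by_cases hz : (Submodule.Quotient.mk z : L.Torus) ∈ S <;> simp [pullback, hz]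

theorem pullback_sub : L.pullback (f - g) = L.pullback f - L.pullback g := by
  funext z
  by_cases hz : (Submodule.Quotient.mk z : L.Torus) ∈ S <;> simp [pullback, hz]

theorem pullback_smul (a : ℂ) : L.pullback (a • f) = a • L.pullback f := by
  funext z
  by_cases hz : (Submodule.Quotient.mk z : L.Torus) ∈ S <;> simp [pullback, hz]

/-- The exponent `0` fails on `S`, where the default value is `0` but `0 ^ 0 = 1`. -/
theorem pullback_pow {k : ℕ} (hk : k ≠ 0) : L.pullback (f ^ k) = L.pullback f ^ k := by
  funext z
  by_cases hz : (Submodule.Quotient.mk z : L.Torus) ∈ S <;> simp [pullback, hz, hk]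

theorem pullback_sum {ι : Type*} (s : Finset ι) (f : ι → L.Punctured S → ℂ) :
    L.pullback (∑ i ∈ s, f i) = ∑ i ∈ s, L.pullback (f i) := by
  funext z
  by_cases hz : (Submodule.Quotient.mk z : L.Torus) ∈ S <;> simp [pullback, hz]

theorem pullback_add_of_mem_lattice {l : ℂ} (hl : l ∈ L.lattice) (z : ℂ) :
    L.pullback f (z + l) = L.pullback f z := by
  by_cases hz : (Submodule.Quotient.mk z : L.Torus) ∈ S
  · rw [pullback_of_mem f hz, pullback_of_mem f (by rwa [L.mk_add_of_mem hl])]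
  · rw [pullback_of_notMem f hz, pullback_of_notMem f (by rwa [L.mk_add_of_mem hl])]
    simp only [L.mk_add_of_mem hl]

variable {f}

theorem mem_regularFunctions_iff (hS : S.Finite) : f ∈ L.regularFunctions S ↔
    Meromorphic (L.pullback f) ∧
      ∀ z, (Submodule.Quotient.mk z : L.Torus) ∉ S → AnalyticAt ℂ (L.pullback f) z := by
  constructor
  · rintro ⟨F, hF, hFf⟩
    refine ⟨fun p => (hF p).congr ?_, fun z hz => (hFf z hz).1.congr ?_⟩
    · filter_upwards [L.eventually_nhdsNE_mk_notMem hS p] with z hz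
      rw [(hFf z hz).2, pullback_of_notMem f hz]
    · filter_upwards [L.eventually_nhds_mk_notMem hS hz] with z hz
      rw [(hFf z hz).2, pullback_of_notMem f hz]
  · rintro ⟨h1, h2⟩
    exact ⟨L.pullback f, h1, fun z hz => ⟨h2 z hz, pullback_of_notMem f hz⟩⟩

theorem eq_const_of_regular (hS : S.Finite) (hf : f ∈ L.regularFunctions S)
    (h : ∀ p, (Submodule.Quotient.mk p : L.Torus) ∈ S →
      ∃ c, HasLeadingCoeffAt (L.pullback f) 0 p c) :
    ∃ c, f = algebraMap ℂ _ c := by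
  obtain ⟨hm, ha⟩ := (mem_regularFunctions_iff hS).1 hf
  obtain ⟨c, hc⟩ := L.exists_eq_of_periodic_of_tendsto hm
    (fun l hl z => pullback_add_of_mem_lattice f hl z) fun p => by
      by_cases hp : (Submodule.Quotient.mk p : L.Torus) ∈ S
      · simpa [HasLeadingCoeffAt] using h p hp
      · exact ⟨_, (ha p hp).continuousAt.tendsto.mono_left nhdsWithin_le_nhds⟩
  refine ⟨c, funext fun x => ?_⟩
  obtain ⟨x, hx⟩ := x
  obtain ⟨z, rfl⟩ := Submodule.Quotient.mk_surjective _ x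
  rw [← pullback_of_notMem f hx, hc z (ha z hx).continuousAt]
  rfl

theorem _root_.HasLeadingCoeffAt.pullback_of_mk_eq {n : ℕ} {p q c : ℂ}
    (h : HasLeadingCoeffAt (L.pullback f) n q c)
    (hpq : (Submodule.Quotient.mk p : L.Torus) = Submodule.Quotient.mk q) :
    HasLeadingCoeffAt (L.pullback f) n p c := by
  have hl := (Submodule.Quotient.eq _).1 hpq.symm
  simpa only [pullback_add_of_mem_lattice f hl] using h.comp_add_const (add_sub_cancel p q)

/-- The pole order depends only on the class of `p`, so finiteness of `S` gives a common bound. -/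
theorem exists_hasLeadingCoeffAt_pullback (hS : S.Finite) (hf : f ∈ L.regularFunctions S) :
    ∃ n, ∀ p, (Submodule.Quotient.mk p : L.Torus) ∈ S →
      ∃ c, HasLeadingCoeffAt (L.pullback f) n p c := by
  have hm := ((mem_regularFunctions_iff hS).1 hf).1
  have h1 : ∀ x : L.Torus, ∃ n, ∀ p, Submodule.Quotient.mk p = x →
      ∃ c, HasLeadingCoeffAt (L.pullback f) n p c := fun x => by
    obtain ⟨q, rfl⟩ := Submodule.Quotient.mk_surjective _ x
    obtain ⟨n, c, hc⟩ := (hm q).exists_hasLeadingCoeffAt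
    exact ⟨n, fun p hp => ⟨c, hc.pullback_of_mk_eq hp⟩⟩
  choose n hn using h1
  refine ⟨hS.toFinset.sup n, fun p hp => ?_⟩
  obtain ⟨c, hc⟩ := hn _ p rfl
  exact hc.exists_of_le (Finset.le_sup (f := n) (hS.mem_toFinset.2 hp))

/-- Reduction of the pole order: an algebra `B` of functions is contained in `A ≤ B` if the leading
coefficients of every function in `B` with poles are those of a function in `A`. -/
theorem le_of_forall_leadingCoeff (hS : S.Finite) {A B : Subalgebra ℂ (L.Punctured S → ℂ)}
    (hAB : A ≤ B) (hB : B ≤ L.regularFunctions S)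
    (h : ∀ (n : ℕ), ∀ f ∈ B, ∀ c : ℂ → ℂ,
      (∀ p, (Submodule.Quotient.mk p : L.Torus) ∈ S →
        HasLeadingCoeffAt (L.pullback f) (n + 1) p (c p)) →
      ∃ g ∈ A, ∀ p, (Submodule.Quotient.mk p : L.Torus) ∈ S →
        HasLeadingCoeffAt (L.pullback g) (n + 1) p (c p)) : B ≤ A := by
  have key : ∀ (n : ℕ), ∀ f ∈ B, (∀ p, (Submodule.Quotient.mk p : L.Torus) ∈ S →
      ∃ c, HasLeadingCoeffAt (L.pullback f) n p c) → f ∈ A := by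
    intro n
    induction n with
    | zero =>
      intro f hf hp
      obtain ⟨c, rfl⟩ := eq_const_of_regular hS (hB hf) hp
      exact A.algebraMap_mem c
    | succ n ih =>
      intro f hf hp
      have hp' : ∀ p, ∃ c, (Submodule.Quotient.mk p : L.Torus) ∈ S →
          HasLeadingCoeffAt (L.pullback f) (n + 1) p c := fun p => by
        by_cases h : (Submodule.Quotient.mk p : L.Torus) ∈ S
        · obtain ⟨c, hc⟩ := hp p h
          exact ⟨c, fun _ => hc⟩
        · exact ⟨0, fun h' => absurd h' h⟩
      choose c hc using hp'
      obtain ⟨g, hg, hgc⟩ := h n f hf c hc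
      rw [← sub_add_cancel f g]
      have hfg := B.sub_mem hf (hAB hg)
      refine A.add_mem (ih _ hfg fun p hpS => ?_) hg
      refine HasLeadingCoeffAt.exists_of_zero (((mem_regularFunctions_iff hS).1 (hB hfg)).1 p) ?_
      simpa [pullback_sub] using (hc p hpS).sub (hgc p hpS)
  intro f hf
  obtain ⟨n, hn⟩ := exists_hasLeadingCoeffAt_pullback hS (hB hf)
  exact key n f hf hn

end pullback

/-! ### Even functions with poles only at `0` -/

theorem mk_mem_singleton_zero_iff (L : PeriodPair) (z : ℂ) :
    (Submodule.Quotient.mk z : L.Torus) ∈ ({0} : Set L.Torus) ↔ z ∈ L.lattice := by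
  rw [Set.mem_singleton_iff, Submodule.Quotient.mk_eq_zero]

theorem pullback_neg_of_even {L : PeriodPair} {f : L.Punctured {0} → ℂ}
    (hf : f ∈ L.evenRegularFunctions {0}) (z : ℂ) : L.pullback f (-z) = L.pullback f z := by
  by_cases hz : (Submodule.Quotient.mk z : L.Torus) ∈ ({0} : Set L.Torus)
  · rw [pullback_of_mem f hz, pullback_of_mem f (by simpa using hz)]
  · have hz' : -(Submodule.Quotient.mk z : L.Torus) ∉ ({0} : Set L.Torus) := by simpa using hz
    rw [pullback_of_notMem f hz, pullback_of_notMem f (by simpa using hz)]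
    exact hf.2 _ hz hz'

/-- The even functions on a torus with poles only at `0` are the polynomials in any given one of
them that has a double pole. -/
theorem adjoin_eq_evenRegularFunctions {L : PeriodPair} {g : L.Punctured {0} → ℂ}
    (hg : g ∈ L.evenRegularFunctions {0}) {d : ℂ} (hd : d ≠ 0)
    (hgd : HasLeadingCoeffAt (L.pullback g) 2 0 d) :
    Algebra.adjoin ℂ {g} = L.evenRegularFunctions {0} := by
  have hle : Algebra.adjoin ℂ {g} ≤ L.evenRegularFunctions {0} :=
    Algebra.adjoin_le (Set.singleton_subset_iff.2 hg)
  refine le_antisymm hle (le_of_forall_leadingCoeff (Set.finite_singleton 0) hle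
    (fun f hf => hf.1) fun n f hf c hc => ?_)
  have h0 : (Submodule.Quotient.mk 0 : L.Torus) ∈ ({0} : Set L.Torus) :=
    (L.mk_mem_singleton_zero_iff 0).2 (zero_mem _)
  have hcp : ∀ p, (Submodule.Quotient.mk p : L.Torus) ∈ ({0} : Set L.Torus) → c p = c 0 :=
    fun p hp => (hc p hp).unique ((hc 0 h0).pullback_of_mk_eq (hp.trans h0.symm))
  suffices ∃ h ∈ Algebra.adjoin ℂ {g}, HasLeadingCoeffAt (L.pullback h) (n + 1) 0 (c 0) by
    obtain ⟨h, hh, hh0⟩ := this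
    exact ⟨h, hh, fun p hp => hcp p hp ▸ hh0.pullback_of_mk_eq (hp.trans h0.symm)⟩
  have hgA : g ∈ Algebra.adjoin ℂ {g} := Algebra.subset_adjoin rfl
  -- In even order `2k` a multiple of `g ^ k` has the required coefficient; in odd order evenness
  -- forces `c 0 = -c 0`, so `0` does.
  rcases Nat.even_or_odd' (n + 1) with ⟨k, hk | hk⟩
  · refine ⟨(c 0 / d ^ k) • g ^ k, Subalgebra.smul_mem _ (pow_mem hgA k) _, ?_⟩
    rw [pullback_smul, pullback_pow g (by omega), hk]
    convert! (hgd.pow k).const_smul (c 0 / d ^ k) using 1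
    rw [div_mul_cancel₀ _ (pow_ne_zero k hd)]
  · refine ⟨0, zero_mem _, ?_⟩
    have h1 := HasLeadingCoeffAt.comp_neg (p := 0) (by simpa using hc 0 h0)
    simp only [pullback_neg_of_even hf] at h1
    have h2 := h1.unique (hc 0 h0)
    rw [hk, Odd.neg_one_pow ⟨k, rfl⟩, neg_one_mul] at h2
    have h3 : c 0 = 0 := self_eq_neg.1 h2.symm
    have h4 := (hc 0 h0).const_smul 0
    rw [← pullback_smul, zero_smul, zero_mul] at h4
    rwa [h3]

theorem puncturedP_mem_evenRegularFunctions (L : PeriodPair) :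
    L.puncturedP ∈ L.evenRegularFunctions {0} := by
  refine ⟨⟨L.weierstrassP, L.meromorphic_weierstrassP, fun z hz =>
    ⟨L.analyticAt_weierstrassP (by rwa [L.mk_mem_singleton_zero_iff] at hz), rfl⟩⟩, ?_⟩
  intro x hx hx'
  obtain ⟨z, rfl⟩ := Submodule.Quotient.mk_surjective _ x
  exact L.weierstrassP_neg z

theorem hasLeadingCoeffAt_puncturedP (L : PeriodPair) :
    HasLeadingCoeffAt (L.pullback L.puncturedP) 2 0 1 := by
  refine HasLeadingCoeffAt.congr (F := L.weierstrassP) ?_ ?_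
  · simpa [HasLeadingCoeffAt] using L.tendsto_sq_mul_weierstrassP
  · filter_upwards [L.eventually_notMem_lattice 0] with z hz
    rw [pullback_of_notMem _ (by rwa [L.mk_mem_singleton_zero_iff])]
    rfl

end PeriodPair

/-! ### Invariance of sums over a full period -/

theorem sum_range_add_one_of_periodic {N : ℕ} {v : ℤ → ℂ} (hv : ∀ n, v (n + N) = v n) :
    ∑ k ∈ Finset.range N, v (k + 1) = ∑ k ∈ Finset.range N, v k := by
  have h1 := Finset.sum_range_succ (fun k : ℕ => v k) N
  have h2 := Finset.sum_range_succ' (fun k : ℕ => v k) N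
  have h3 := hv 0
  push_cast at h1 h2
  rw [zero_add] at h3
  rw [h1, h3] at h2
  exact (add_right_cancel h2).symm

theorem sum_range_neg_of_periodic {N : ℕ} {v : ℤ → ℂ} (hv : ∀ n, v (n + N) = v n) :
    ∑ k ∈ Finset.range N, v (-k) = ∑ k ∈ Finset.range N, v k := by
  rw [← sum_range_add_one_of_periodic hv, ← Finset.sum_range_reflect]
  refine Finset.sum_congr rfl fun k hk => ?_
  have hk' := Finset.mem_range.1 hk
  rw [← hv, show -((N - 1 - k : ℕ) : ℤ) + N = k + 1 by omega]

/-! ### Poles and residues of `℘' / (℘ - ℘(a))` -/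

namespace PeriodPair

/-- The elliptic function `℘' / (℘ - ℘(a))`. -/
def logDerivP (L : PeriodPair) (a z : ℂ) : ℂ :=
  L.derivWeierstrassP z / (L.weierstrassP z - L.weierstrassP a)

section logDerivP

variable (L : PeriodPair) (a : ℂ)

theorem meromorphic_logDerivP : Meromorphic (L.logDerivP a) :=
  L.meromorphic_derivWeierstrassP.div (L.meromorphic_weierstrassP.sub (.const _))

theorem logDerivP_neg (z : ℂ) : L.logDerivP a (-z) = -L.logDerivP a z := by
  simp [logDerivP, neg_div]

theorem logDerivP_add_of_mem {l : ℂ} (hl : l ∈ L.lattice) (z : ℂ) :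
    L.logDerivP a (z + l) = L.logDerivP a z := by
  rw [logDerivP, logDerivP, L.weierstrassP_add_coe z ⟨l, hl⟩, L.derivWeierstrassP_add_coe z ⟨l, hl⟩]

variable {a}

theorem analyticAt_logDerivP (ha : a ∉ L.lattice) {z : ℂ} (h0 : z ∉ L.lattice)
    (h1 : z - a ∉ L.lattice) (h2 : z + a ∉ L.lattice) : AnalyticAt ℂ (L.logDerivP a) z :=
  (L.analyticAt_derivWeierstrassP h0).div ((L.analyticAt_weierstrassP h0).sub analyticAt_const)
    (sub_ne_zero.2 fun h => ((L.weierstrassP_eq_iff h0 ha).1 h).elim h1 h2)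

variable (a) in
theorem hasLeadingCoeffAt_logDerivP_zero : HasLeadingCoeffAt (L.logDerivP a) 1 0 (-2) := by
  have h1 : Tendsto (fun z : ℂ => z ^ 2 * L.weierstrassP a) (𝓝[≠] 0) (𝓝 0) := by
    have : Continuous fun z : ℂ => z ^ 2 * L.weierstrassP a := by fun_prop
    simpa using (this.tendsto 0).mono_left nhdsWithin_le_nhds
  have h2 := L.tendsto_cube_mul_derivWeierstrassP.div (L.tendsto_sq_mul_weierstrassP.sub h1)
    (by norm_num)
  rw [sub_zero, div_one] at h2
  refine h2.congr' ?_
  filter_upwards [self_mem_nhdsWithin] with z hz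
  have hz' : z ≠ 0 := hz
  rw [logDerivP, Pi.div_apply, ← mul_sub, sub_zero, pow_one, show z ^ 3 = z ^ 2 * z by ring,
    mul_assoc, mul_div_mul_left _ _ (pow_ne_zero 2 hz'), mul_div_assoc]

/-- A logarithmic derivative has residue `1` at a simple zero; the zero of `℘ - ℘(a)` is simple
because `℘'(a) ≠ 0`. -/
theorem hasLeadingCoeffAt_logDerivP_self (ha : a + a ∉ L.lattice) :
    HasLeadingCoeffAt (L.logDerivP a) 1 a 1 := by
  have haL : a ∉ L.lattice := fun h => ha (add_mem h h)
  have h0 := L.derivWeierstrassP_ne_zero ha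
  have h1 := hasDerivAt_iff_tendsto_slope.1 (L.hasDerivAt_weierstrassP haL)
  have h2 := ((L.analyticAt_derivWeierstrassP haL).continuousAt.tendsto.mono_left
    (nhdsWithin_le_nhds (s := {a}ᶜ))).div h1 h0
  rw [div_self h0] at h2
  refine h2.congr fun z => ?_
  rw [Pi.div_apply, slope_def_field, logDerivP, pow_one, div_div_eq_mul_div, mul_comm,
    mul_div_assoc]

theorem hasLeadingCoeffAt_logDerivP_neg (ha : a + a ∉ L.lattice) :
    HasLeadingCoeffAt (L.logDerivP a) 1 (-a) 1 := by
  have h := (HasLeadingCoeffAt.comp_neg (p := -a)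
    (by simpa using L.hasLeadingCoeffAt_logDerivP_self ha)).const_smul (-1)
  convert! h using 1
  · funext z; simp [logDerivP_neg]
  · simp

end logDerivP

/-! ### The functions `P_j`: transformation laws and residues -/

/-- The root of unity `exp (2πi/N)`. -/
def rootOfUnity (N : ℕ) : ℂ := Complex.exp (2 * Real.pi * Complex.I / N)

theorem isPrimitiveRoot_rootOfUnity {N : ℕ} (hN : N ≠ 0) : IsPrimitiveRoot (rootOfUnity N) N :=
  Complex.isPrimitiveRoot_exp N hN

theorem rootOfUnity_ne_zero (N : ℕ) : rootOfUnity N ≠ 0 := Complex.exp_ne_zero _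

theorem rootOfUnity_zpow_eq_of_dvd {N : ℕ} (hN : N ≠ 0) {m n : ℤ} (h : (N : ℤ) ∣ m - n) :
    rootOfUnity N ^ m = rootOfUnity N ^ n := by
  rw [← sub_add_cancel m n, zpow_add₀ (rootOfUnity_ne_zero N),
    ((isPrimitiveRoot_rootOfUnity hN).zpow_eq_one_iff_dvd _).2 h, one_mul]

/-- The residue of `P_j` at `0`. -/
def projResidue (N : ℕ) (j : ℤ) : ℂ := -2 + rootOfUnity N ^ (-j) + rootOfUnity N ^ j

theorem projResidue_neg (N : ℕ) (j : ℤ) : projResidue N (-j) = projResidue N j := by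
  rw [projResidue, projResidue, neg_neg]; ring

/-- Multiplied by `ω^j`, the residue becomes `(ω^j - 1)^2`. -/
theorem projResidue_ne_zero {N : ℕ} (hN : N ≠ 0) {j : ℤ} (hj : ¬ (N : ℤ) ∣ j) :
    projResidue N j ≠ 0 := by
  intro h
  have h0 : rootOfUnity N ^ j ≠ 0 := zpow_ne_zero j (rootOfUnity_ne_zero N)
  rw [projResidue, zpow_neg] at h
  have h1 : (rootOfUnity N ^ j - 1) ^ 2 = 0 := by
    field_simp at h
    linear_combination h
  refine hj (((isPrimitiveRoot_rootOfUnity hN).zpow_eq_one_iff_dvd j).1 ?_)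
  exact sub_eq_zero.1 (pow_eq_zero_iff two_ne_zero |>.1 h1)

/-- The function `P_j` as a meromorphic function on `ℂ`. -/
def projMeromorphic (L : PeriodPair) (N : ℕ) (a : ℂ) (j : ℤ) (z : ℂ) : ℂ :=
  ∑ k ∈ Finset.range N, rootOfUnity N ^ (-((k : ℤ) * j)) * L.logDerivP a (z + -((k : ℤ) * a))

section proj

variable {L : PeriodPair} {N : ℕ} {a : ℂ}

theorem zsmul_mk (n : ℤ) : n • (Submodule.Quotient.mk a : L.Torus) =
    Submodule.Quotient.mk ((n : ℂ) * a) := by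
  rw [← Submodule.Quotient.mk_smul, zsmul_eq_mul]

theorem intCast_mul_mem_lattice_iff (ha : addOrderOf (Submodule.Quotient.mk a : L.Torus) = N)
    (n : ℤ) : (n : ℂ) * a ∈ L.lattice ↔ (N : ℤ) ∣ n := by
  rw [← Submodule.Quotient.mk_eq_zero, ← zsmul_mk, ← ha, addOrderOf_dvd_iff_zsmul_eq_zero]

theorem mk_mem_orbit_iff {z : ℂ} :
    (Submodule.Quotient.mk z : L.Torus) ∈ L.orbit (Submodule.Quotient.mk a) ↔
      ∃ m : ℤ, (Submodule.Quotient.mk z : L.Torus) = Submodule.Quotient.mk ((m : ℂ) * a) := by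
  simp only [orbit, SetLike.mem_coe, AddSubgroup.mem_zmultiples_iff, zsmul_mk, eq_comm]

theorem mk_add_mul_mem_orbit_iff {z : ℂ} (m : ℤ) :
    (Submodule.Quotient.mk (z + m * a) : L.Torus) ∈ L.orbit (Submodule.Quotient.mk a) ↔
      (Submodule.Quotient.mk z : L.Torus) ∈ L.orbit (Submodule.Quotient.mk a) := by
  rw [Submodule.Quotient.mk_add, ← zsmul_mk]
  exact AddSubgroup.add_mem_cancel_right _ (AddSubgroup.zsmul_mem_zmultiples _ m)

variable (L) in
theorem rootOfUnity_zpow_mul_logDerivP_periodic (hN : N ≠ 0)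
    (ha : addOrderOf (Submodule.Quotient.mk a : L.Torus) = N) (j : ℤ) (z : ℂ) (n : ℤ) :
    rootOfUnity N ^ (-((n + N) * j)) * L.logDerivP a (z + -(((n + N : ℤ) : ℂ) * a)) =
      rootOfUnity N ^ (-(n * j)) * L.logDerivP a (z + -((n : ℂ) * a)) := by
  have hl : ((-N : ℤ) : ℂ) * a ∈ L.lattice := (intCast_mul_mem_lattice_iff ha _).2 (by simp)
  have e : z + -(((n + N : ℤ) : ℂ) * a) = z + -((n : ℂ) * a) + ((-N : ℤ) : ℂ) * a := by
    push_cast; ring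
  rw [rootOfUnity_zpow_eq_of_dvd hN (n := -(n * j)) ⟨-j, by ring⟩, e, L.logDerivP_add_of_mem a hl]

/-- Translation by `a` shifts the summation index by one, and the summand is `N`-periodic in that
index. -/
theorem projMeromorphic_add_self (hN : N ≠ 0)
    (ha : addOrderOf (Submodule.Quotient.mk a : L.Torus) = N) (j : ℤ) (z : ℂ) :
    L.projMeromorphic N a j (z + a) = rootOfUnity N ^ (-j) * L.projMeromorphic N a j z := by
  have h := sum_range_add_one_of_periodic
    (v := fun k => rootOfUnity N ^ (-(k * j)) * L.logDerivP a (z + a + -((k : ℂ) * a)))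
    (L.rootOfUnity_zpow_mul_logDerivP_periodic hN ha j (z + a))
  rw [projMeromorphic, projMeromorphic, Finset.mul_sum]
  refine (Eq.trans ?_ h.symm).trans (Finset.sum_congr rfl fun k _ => ?_)
  · simp
  · rw [← mul_assoc, ← zpow_add₀ (rootOfUnity_ne_zero N)]
    congr 2
    · ring
    · push_cast; ring

theorem projMeromorphic_add (hN : N ≠ 0)
    (ha : addOrderOf (Submodule.Quotient.mk a : L.Torus) = N) (j : ℤ) (m : ℤ) (z : ℂ) :
    L.projMeromorphic N a j (z + m * a) =
      rootOfUnity N ^ (-(m * j)) * L.projMeromorphic N a j z := by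
  induction m using Int.induction_on with
  | zero => simp
  | succ m ih =>
    rw [show z + ((m + 1 : ℤ) : ℂ) * a = z + (m : ℤ) * a + a by push_cast; ring,
      projMeromorphic_add_self hN ha, ih, ← mul_assoc, ← zpow_add₀ (rootOfUnity_ne_zero N)]
    congr 2; ring
  | pred m ih =>
    have h := projMeromorphic_add_self hN ha j (z + ((-m - 1 : ℤ) : ℂ) * a)
    rw [show z + ((-m - 1 : ℤ) : ℂ) * a + a = z + ((-m : ℤ) : ℂ) * a by push_cast; ring, ih] at h
    rw [show -((-(m : ℤ) - 1) * j) = j + -(-(m : ℤ) * j) by ring,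
      zpow_add₀ (rootOfUnity_ne_zero N), mul_assoc, h, ← mul_assoc,
      ← zpow_add₀ (rootOfUnity_ne_zero N)]
    simp

theorem projMeromorphic_neg (hN : N ≠ 0)
    (ha : addOrderOf (Submodule.Quotient.mk a : L.Torus) = N) (j : ℤ) (z : ℂ) :
    L.projMeromorphic N a j (-z) = -L.projMeromorphic N a (-j) z := by
  have h := sum_range_neg_of_periodic
    (v := fun k => rootOfUnity N ^ (-(k * j)) * L.logDerivP a (-z + -((k : ℂ) * a)))
    (L.rootOfUnity_zpow_mul_logDerivP_periodic hN ha j (-z))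
  rw [projMeromorphic, projMeromorphic, ← Finset.sum_neg_distrib]
  refine (Eq.trans ?_ h.symm).trans (Finset.sum_congr rfl fun k _ => ?_)
  · simp
  · rw [show -z + -(((-k : ℤ) : ℂ) * a) = -(z + -((k : ℤ) * a)) by push_cast; ring,
      logDerivP_neg, mul_neg]
    congr 3
    ring

theorem meromorphic_projMeromorphic (j : ℤ) : Meromorphic (L.projMeromorphic N a j) := by
  have : L.projMeromorphic N a j = ∑ k ∈ Finset.range N, fun z =>
      rootOfUnity N ^ (-((k : ℤ) * j)) * L.logDerivP a (z + -((k : ℤ) * a)) := by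
    funext z; simp [projMeromorphic]
  rw [this]
  exact Meromorphic.sum fun k _ =>
    (Meromorphic.const _).mul ((L.meromorphic_logDerivP a).comp_add_const _)

theorem analyticAt_projMeromorphic (j : ℤ) {z : ℂ} (haL : a ∉ L.lattice)
    (hz : (Submodule.Quotient.mk z : L.Torus) ∉ L.orbit (Submodule.Quotient.mk a)) :
    AnalyticAt ℂ (L.projMeromorphic N a j) z := by
  have hz' : ∀ m : ℤ, z + m * a ∉ L.lattice := fun m h => by
    rw [← mk_add_mul_mem_orbit_iff m, (Submodule.Quotient.mk_eq_zero _).2 h] at hz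
    exact hz (zero_mem _)
  refine Finset.analyticAt_fun_sum _ fun k _ => analyticAt_const.mul
    (AnalyticAt.comp (g := L.logDerivP a) (L.analyticAt_logDerivP haL ?_ ?_ ?_) (by fun_prop))
  · convert! hz' (-k) using 2; push_cast; ring
  · convert! hz' (-k - 1) using 2; push_cast; ring
  · convert! hz' (-k + 1) using 2; push_cast; ring

theorem hasLeadingCoeffAt_projMeromorphic (hN : 3 ≤ N)
    (ha : addOrderOf (Submodule.Quotient.mk a : L.Torus) = N) (j : ℤ) :
    HasLeadingCoeffAt (L.projMeromorphic N a j) 1 0 (projResidue N j) := by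
  have hmem := intCast_mul_mem_lattice_iff ha
  have haa : a + a ∉ L.lattice := fun h => by
    have := Int.le_of_dvd (by norm_num) ((hmem 2).1 (by convert! h using 1; push_cast; ring))
    omega
  have haL : a ∉ L.lattice := fun h => haa (add_mem h h)
  -- The `k`-th term contributes the residue of `℘'/(℘ - ℘(a))` at `-ka`. This point is a pole only
  -- when it is `0`, `-a` or `a` modulo the lattice, that is, for `k = 0`, `1`, `N - 1`.
  set c : ℕ → ℂ := fun k => ((if k = 0 then -2 else 0) +
    (if k = 1 then rootOfUnity N ^ (-j) else 0)) + (if k = N - 1 then rootOfUnity N ^ j else 0)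
  have hc : ∑ k ∈ Finset.range N, c k = projResidue N j := by
    simp only [c, Finset.sum_add_distrib, Finset.sum_ite_eq', Finset.mem_range]
    rw [if_pos (by omega), if_pos (by omega), if_pos (by omega), projResidue]
  rw [← hc]
  have hsum : L.projMeromorphic N a j = ∑ k ∈ Finset.range N,
      rootOfUnity N ^ (-((k : ℤ) * j)) • fun z => L.logDerivP a (z + -((k : ℤ) * a)) := by
    funext z; simp [projMeromorphic]
  rw [hsum]
  refine HasLeadingCoeffAt.sum _ fun k hk => ?_
  have hkN := Finset.mem_range.1 hk
  suffices ∃ r, HasLeadingCoeffAt (L.logDerivP a) 1 (-((k : ℤ) * a)) r ∧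
      rootOfUnity N ^ (-((k : ℤ) * j)) * r = c k by
    obtain ⟨r, hr, hrc⟩ := this
    rw [← hrc]
    exact (hr.comp_add_const (zero_add _)).const_smul _
  by_cases h0 : k = 0
  · refine ⟨-2, by simpa [h0] using L.hasLeadingCoeffAt_logDerivP_zero a, ?_⟩
    simp [c, h0, show 0 ≠ N - 1 by omega]
  by_cases h1 : k = 1
  · refine ⟨1, by simpa [h1] using L.hasLeadingCoeffAt_logDerivP_neg haa, ?_⟩
    simp [c, h1, show 1 ≠ N - 1 by omega]
  by_cases h2 : k = N - 1
  · refine ⟨1, ?_, ?_⟩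
    · have hl : (N : ℤ) * a ∈ L.lattice := by simpa using (hmem N).2 dvd_rfl
      have h := (L.hasLeadingCoeffAt_logDerivP_self haa).comp_add_const
        (q := -((k : ℤ) * a)) (l := (N : ℤ) * a)
        (by rw [h2]; push_cast [Nat.cast_sub (show 1 ≤ N by omega)]; ring)
      simpa only [L.logDerivP_add_of_mem a hl] using h
    · simp only [c, h2, if_true, mul_one]
      rw [if_neg (by omega), if_neg (by omega), zero_add, zero_add]
      exact rootOfUnity_zpow_eq_of_dvd (by omega) ⟨-j, by
        push_cast [Nat.cast_sub (show 1 ≤ N by omega)]; ring⟩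
  · refine ⟨0, HasLeadingCoeffAt.zero_of_lt (HasLeadingCoeffAt.of_continuousAt
      (L.analyticAt_logDerivP haL ?_ ?_ ?_).continuousAt) zero_lt_one, by simp [c, h0, h1, h2]⟩
    · intro h
      obtain ⟨d, hd⟩ := (hmem (-k)).1 (by convert! h using 1; push_cast; ring)
      have := Int.le_of_dvd (by omega) (show (N : ℤ) ∣ k from ⟨-d, by linarith⟩)
      omega
    · intro h
      obtain ⟨d, hd⟩ := (hmem (-k - 1)).1 (by convert! h using 1; push_cast; ring)
      have := Int.le_of_dvd (by omega) (show (N : ℤ) ∣ k + 1 from ⟨-d, by linarith⟩)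
      omega
    · intro h
      obtain ⟨d, hd⟩ := (hmem (-k + 1)).1 (by convert! h using 1; push_cast; ring)
      have := Int.le_of_dvd (by omega) (show (N : ℤ) ∣ k - 1 from ⟨-d, by linarith⟩)
      omega

theorem projP_mk (j : ℤ) {z : ℂ}
    (hz : (Submodule.Quotient.mk z : L.Torus) ∉ L.orbit (Submodule.Quotient.mk a)) :
    L.projP N (Submodule.Quotient.mk a) j ⟨Submodule.Quotient.mk z, hz⟩ =
      L.projMeromorphic N a j z := by
  rw [projP, projMeromorphic]
  refine Finset.sum_congr rfl fun k _ => ?_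
  rw [← Submodule.Quotient.mk_smul, ← Submodule.Quotient.mk_sub, torusP_mk, torusP_mk, torusP'_mk,
    logDerivP, zpow_neg, rootOfUnity, nsmul_eq_mul, ← sub_eq_add_neg, Int.cast_natCast]
  field_simp

theorem finite_orbit (hN : N ≠ 0) (ha : addOrderOf (Submodule.Quotient.mk a : L.Torus) = N) :
    (L.orbit (Submodule.Quotient.mk a)).Finite :=
  (addOrderOf_pos_iff.1 (by omega)).finite_zmultiples

theorem pullback_projP_eventuallyEq (hN : N ≠ 0)
    (ha : addOrderOf (Submodule.Quotient.mk a : L.Torus) = N) (j : ℤ) (p : ℂ) :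
    L.projMeromorphic N a j =ᶠ[𝓝[≠] p] L.pullback (L.projP N (Submodule.Quotient.mk a) j) := by
  filter_upwards [L.eventually_nhdsNE_mk_notMem (finite_orbit hN ha) p] with z hz
  rw [pullback_of_notMem _ hz, projP_mk]

theorem projP_mem_regularFunctions (hN : 2 ≤ N)
    (ha : addOrderOf (Submodule.Quotient.mk a : L.Torus) = N) (j : ℤ) :
    L.projP N (Submodule.Quotient.mk a) j ∈
      L.regularFunctions (L.orbit (Submodule.Quotient.mk a)) := by
  refine ⟨L.projMeromorphic N a j, meromorphic_projMeromorphic j, fun z hz =>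
    ⟨analyticAt_projMeromorphic j (fun h => ?_) hz, (projP_mk j hz).symm⟩⟩
  rw [(Submodule.Quotient.mk_eq_zero _).2 h, addOrderOf_zero] at ha
  omega

theorem hasLeadingCoeffAt_projP (hN : 3 ≤ N)
    (ha : addOrderOf (Submodule.Quotient.mk a : L.Torus) = N) (j m : ℤ) :
    HasLeadingCoeffAt (L.pullback (L.projP N (Submodule.Quotient.mk a) j)) 1 (m * a)
      (projResidue N j * rootOfUnity N ^ (-(m * j))) := by
  refine HasLeadingCoeffAt.congr ?_ (pullback_projP_eventuallyEq (by omega) ha j _)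
  have h := ((hasLeadingCoeffAt_projMeromorphic hN ha j).comp_add_const (q := m * a)
    (l := ((-m : ℤ) : ℂ) * a) (by push_cast; ring)).const_smul (rootOfUnity N ^ (-(m * j)))
  rw [mul_comm (projResidue N j)]
  convert! h using 1
  funext z
  rw [Pi.smul_apply, projMeromorphic_add (by omega) ha, smul_eq_mul, ← mul_assoc,
    ← zpow_add₀ (rootOfUnity_ne_zero N)]
  simp

end proj

/-! ### Characters of `ℤ/N` -/

/-- Every `N`-periodic sequence is a combination of the characters of `ℤ / N`. -/
theorem exists_eq_sum_rootOfUnity {N : ℕ} (hN : N ≠ 0) {u : ℤ → ℂ} (hu : ∀ n, u (n + N) = u n) :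
    ∃ b : ℕ → ℂ, ∀ m, u m = ∑ j ∈ Finset.range N, b j * rootOfUnity N ^ (-(m * (j : ℤ))) := by
  set v : ℕ → ℂ := fun k => rootOfUnity N ^ (-(k : ℤ))
  have hv : Set.InjOn v (Finset.range N : Finset ℕ) := fun i hi k hk h => by
    simp only [Finset.coe_range, Set.mem_Iio] at hi hk
    simp only [v, zpow_neg, zpow_natCast, inv_inj] at h
    exact (isPrimitiveRoot_rootOfUnity hN).pow_inj hi hk h
  -- Interpolating `u` at the `N` distinct nodes `ω^(-k)` by a polynomial of degree below `N`, its
  -- coefficients are the Fourier coefficients.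
  set p := Lagrange.interpolate (Finset.range N) v fun k => u k
  have hdeg : p.natDegree < N := by
    have h := Lagrange.degree_interpolate_lt (fun k : ℕ => u k) hv
    rw [Finset.card_range] at h
    by_cases hp : p = 0
    · rw [hp, Polynomial.natDegree_zero]; omega
    · exact (Polynomial.natDegree_lt_iff_degree_lt hp).2 h
  refine ⟨p.coeff, fun m => ?_⟩
  have hN' : (N : ℤ) ≠ 0 := by exact_mod_cast hN
  obtain ⟨k, hk⟩ := Int.eq_ofNat_of_zero_le (Int.emod_nonneg m hN')
  have hkN : k < N := by
    have := Int.emod_lt_of_pos m (show (0 : ℤ) < N by omega)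
    omega
  have hmk : m = k + (m / N) * N := by
    have := Int.emod_add_mul_ediv m N
    rw [hk] at this
    linarith
  have hum : u m = u k := by
    have hper : Function.Periodic u (N : ℤ) := hu
    rw [hmk]
    exact hper.int_mul (m / N) k
  have hev := Lagrange.eval_interpolate_at_node (fun k : ℕ => u k) hv (Finset.mem_range.2 hkN)
  rw [hum, ← hev, Polynomial.eval_eq_sum_range' hdeg]
  refine Finset.sum_congr rfl fun j _ => ?_
  rw [← zpow_natCast, ← zpow_mul]
  congr 1
  refine rootOfUnity_zpow_eq_of_dvd hN ⟨(m / N) * j, ?_⟩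
  linear_combination (j : ℤ) * hmk

theorem sum_rootOfUnity_eq_zero {N : ℕ} (hN : N ≠ 0) {j : ℕ} (h0 : j ≠ 0) (hj : j < N) :
    ∑ k ∈ Finset.range N, rootOfUnity N ^ (-((k : ℤ) * (j : ℤ))) = 0 := by
  have hprim := isPrimitiveRoot_rootOfUnity hN
  set x := rootOfUnity N ^ (-(j : ℤ)) with hx
  have hx1 : x ≠ 1 := fun h => by
    have h1 := (hprim.zpow_eq_one_iff_dvd _).1 h
    have := Int.le_of_dvd (by omega) ((dvd_neg).1 h1)
    omega
  have hxN : x ^ N = 1 := by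
    rw [hx, ← zpow_natCast, ← zpow_mul, hprim.zpow_eq_one_iff_dvd]
    exact dvd_mul_left _ _
  have h := geom_sum_mul x N
  rw [hxN, sub_self] at h
  rw [← (mul_eq_zero.1 h).resolve_right (sub_ne_zero.2 hx1)]
  refine Finset.sum_congr rfl fun k _ => ?_
  rw [hx, ← zpow_natCast, ← zpow_mul]
  congr 1; ring

/-! ### The residue theorem on the orbit, and generation by the `P_j` -/

section

variable {L : PeriodPair} {N : ℕ} {a : ℂ}

/-- The residue theorem for functions with at most simple poles at the multiples of a torsion
point. -/
theorem sum_residue_eq_zero (hN : N ≠ 0) (ha : addOrderOf (Submodule.Quotient.mk a : L.Torus) = N)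
    {f : L.Punctured (L.orbit (Submodule.Quotient.mk a)) → ℂ}
    (hf : f ∈ L.regularFunctions (L.orbit (Submodule.Quotient.mk a))) {c : ℕ → ℂ}
    (hc : ∀ k < N, HasLeadingCoeffAt (L.pullback f) 1 (k * a) (c k)) :
    ∑ k ∈ Finset.range N, c k = 0 := by
  obtain ⟨L', hL'⟩ := L.exists_lattice_eq_torsionLattice (Submodule.Quotient.mk a)
    (addOrderOf_pos_iff.1 (by omega))
  obtain ⟨hm, han⟩ := (mem_regularFunctions_iff (finite_orbit hN ha)).1 hf
  -- Summing over translates gives a function elliptic for `Λ_(α)`, with poles only on that lattice,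
  -- whose residue at `0` is the sum of all the residues of `f`.
  set G : ℂ → ℂ := ∑ k ∈ Finset.range N, fun z => L.pullback f (z + k * a) with hG
  have hGl : ∀ l ∈ L.lattice, ∀ z, G (z + l) = G z := fun l hl z => by
    simp only [hG, Finset.sum_apply, add_right_comm z l, pullback_add_of_mem_lattice f hl]
  have hGa : Function.Periodic G a := fun z => by
    have hNa : (N : ℂ) * a ∈ L.lattice := by
      simpa using (intCast_mul_mem_lattice_iff ha N).2 dvd_rfl
    have h := sum_range_add_one_of_periodic (N := N)
      (v := fun k : ℤ => L.pullback f (z + k * a)) fun n => by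
        rw [← pullback_add_of_mem_lattice f hNa (z + n * a)]
        congr 1; push_cast; ring
    simp only [hG, Finset.sum_apply]
    convert! h using 3 with k
    push_cast; ring
  refine L'.residue_eq_zero (F := G) (Meromorphic.sum fun k _ => hm.comp_add_const _) ?_ ?_ ?_
  · intro l hl z
    rw [hL', mem_torsionLattice_iff, mk_mem_orbit_iff] at hl
    obtain ⟨m, hlm⟩ := hl
    have h1 := hGl _ ((Submodule.Quotient.eq _).1 hlm) (z + m * a)
    rw [show z + m * a + (l - m * a) = z + l by ring] at h1
    rw [h1, hGa.int_mul m z]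
  · intro z hz
    rw [hL', mem_torsionLattice_iff] at hz
    refine Finset.analyticAt_sum _ fun k _ =>
      AnalyticAt.comp (g := L.pullback f) (han _ ?_) (by fun_prop)
    simpa using mt (mk_add_mul_mem_orbit_iff (k : ℤ)).1 hz
  · have h := HasLeadingCoeffAt.sum (p := 0) (Finset.range N) fun k hk =>
      (hc k (Finset.mem_range.1 hk)).comp_add_const (q := 0) (zero_add _)
    simpa [HasLeadingCoeffAt, hG] using h

theorem projP_congr (hN : N ≠ 0) (α : L.Torus) {i j : ℤ} (hij : (N : ℤ) ∣ i - j) :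
    L.projP N α i = L.projP N α j := by
  funext x
  refine Finset.sum_congr rfl fun k _ => ?_
  have h : (N : ℤ) ∣ (k : ℤ) * i - k * j := by rw [← mul_sub]; exact hij.mul_left _
  have h2 := rootOfUnity_zpow_eq_of_dvd hN h
  rw [rootOfUnity] at h2
  rw [h2]

variable (L) in
/-- The algebra generated by `P_1, …, P_{N-1}`. -/
abbrev projAlgebra (N : ℕ) (α : L.Torus) : Subalgebra ℂ (L.Punctured (L.orbit α) → ℂ) :=
  Algebra.adjoin ℂ {f | ∃ j : ℤ, 1 ≤ j ∧ j ≤ (N : ℤ) - 1 ∧ f = L.projP N α j}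

theorem projP_mem_projAlgebra (hN : N ≠ 0) (α : L.Torus) {j : ℤ} (hj : ¬ (N : ℤ) ∣ j) :
    L.projP N α j ∈ L.projAlgebra N α := by
  have hN' : (0 : ℤ) < N := by omega
  have h0 := Int.emod_nonneg j hN'.ne'
  have h1 := Int.emod_lt_of_pos j hN'
  have h2 : j % N ≠ 0 := fun h => hj (Int.dvd_of_emod_eq_zero h)
  rw [projP_congr hN α (Int.dvd_self_sub_emod (x := j) (m := N))]
  exact Algebra.subset_adjoin ⟨j % N, by omega, by omega, rfl⟩

/-- Leading coefficients multiply, so a product of `n + 1` functions `P_i` realises the product of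
their characters. Only the trivial character in order one is out of reach. -/
theorem exists_mem_projAlgebra_hasLeadingCoeffAt (hN : 3 ≤ N)
    (ha : addOrderOf (Submodule.Quotient.mk a : L.Torus) = N) (n : ℕ) :
    ∀ j : ℤ, (n = 0 → ¬ (N : ℤ) ∣ j) → ∃ g ∈ L.projAlgebra N (Submodule.Quotient.mk a),
      ∃ κ : ℂ, κ ≠ 0 ∧ ∀ m : ℤ, HasLeadingCoeffAt (L.pullback g) (n + 1) (m * a)
        (κ * rootOfUnity N ^ (-(m * j))) := by
  induction n with
  | zero =>
    intro j hj
    exact ⟨_, projP_mem_projAlgebra (by omega) _ (hj rfl), projResidue N j,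
      projResidue_ne_zero (by omega) (hj rfl), hasLeadingCoeffAt_projP hN ha j⟩
  | succ n ih =>
    intro j _
    -- Both `i` and `j - i` must be nonzero modulo `N`. As `N ≥ 3`, `i = 1` works unless `j ≡ 1`,
    -- and then `i = 2` does.
    obtain ⟨i, hi, hji⟩ : ∃ i : ℤ, ¬ (N : ℤ) ∣ i ∧ ¬ (N : ℤ) ∣ j - i := by
      have h1 : ¬ (N : ℤ) ∣ 1 := fun h => by
        have := Int.le_of_dvd one_pos h
        omega
      have h2 : ¬ (N : ℤ) ∣ 2 := fun h => by
        have := Int.le_of_dvd two_pos h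
        omega
      by_cases h : (N : ℤ) ∣ j - 1
      · exact ⟨2, h2, fun h' => h1 (by convert! dvd_sub h h' using 1; ring)⟩
      · exact ⟨1, h1, h⟩
    obtain ⟨g, hg, κ, hκ, hgκ⟩ := ih (j - i) fun _ => hji
    refine ⟨g * L.projP N _ i, mul_mem hg (projP_mem_projAlgebra (by omega) _ hi),
      κ * projResidue N i, mul_ne_zero hκ (projResidue_ne_zero (by omega) hi), fun m => ?_⟩
    rw [pullback_mul]
    convert! (hgκ m).mul (hasLeadingCoeffAt_projP hN ha i m) using 1
    rw [show -(m * j) = -(m * (j - i)) + -(m * i) by ring, zpow_add₀ (rootOfUnity_ne_zero N)]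
    ring

theorem projAlgebra_eq_regularFunctions (hN : 3 ≤ N)
    (ha : addOrderOf (Submodule.Quotient.mk a : L.Torus) = N) :
    L.projAlgebra N (Submodule.Quotient.mk a) =
      L.regularFunctions (L.orbit (Submodule.Quotient.mk a)) := by
  have hN0 : N ≠ 0 := by omega
  have hle : L.projAlgebra N (Submodule.Quotient.mk a) ≤
      L.regularFunctions (L.orbit (Submodule.Quotient.mk a)) := by
    refine Algebra.adjoin_le ?_
    rintro _ ⟨j, _, _, rfl⟩
    exact projP_mem_regularFunctions (by omega) ha j
  refine le_antisymm hle (le_of_forall_leadingCoeff (finite_orbit hN0 ha) hle le_rfl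
    fun n f hf c hc => ?_)
  have hcm : ∀ m : ℤ, HasLeadingCoeffAt (L.pullback f) (n + 1) (m * a) (c (m * a)) := fun m =>
    hc _ (mk_mem_orbit_iff.2 ⟨m, rfl⟩)
  have hper : ∀ m : ℤ, c (((m + N : ℤ) : ℂ) * a) = c (m * a) := fun m => by
    refine (hcm _).unique ((hcm m).pullback_of_mk_eq ((Submodule.Quotient.eq _).2 ?_))
    rw [← sub_mul, ← Int.cast_sub, intCast_mul_mem_lattice_iff ha]
    simp
  obtain ⟨b, hb⟩ := exists_eq_sum_rootOfUnity hN0 (u := fun m => c (m * a)) hper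
  -- For simple poles the residues sum to `N * b 0`, since nontrivial characters sum to zero.
  have hb0 : n = 0 → b 0 = 0 := fun hn => by
    subst hn
    have h1 := sum_residue_eq_zero hN0 ha hf (c := fun k => c (k * a)) fun k _ => by
      simpa using hcm k
    have h2 : ∀ k : ℕ, c (k * a) =
        ∑ j ∈ Finset.range N, b j * rootOfUnity N ^ (-((k : ℤ) * (j : ℤ))) := fun k => by
      simpa using hb k
    simp only [h2] at h1
    rw [Finset.sum_comm, Finset.sum_eq_single_of_mem 0 (Finset.mem_range.2 (by omega))] at h1
    · simpa [hN0] using h1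
    · intro j hj hj0
      rw [← Finset.mul_sum, sum_rootOfUnity_eq_zero hN0 hj0 (Finset.mem_range.1 hj), mul_zero]
  have hg : ∀ j ∈ Finset.range N, ∃ g ∈ L.projAlgebra N (Submodule.Quotient.mk a),
      ∀ m : ℤ, HasLeadingCoeffAt (L.pullback g) (n + 1) (m * a)
        (b j * rootOfUnity N ^ (-(m * (j : ℤ)))) := fun j hj => by
    by_cases h : n = 0 ∧ j = 0
    · refine ⟨(0 : ℂ) • f, by rw [zero_smul]; exact zero_mem _, fun m => ?_⟩
      have h0 : b j = 0 := h.2 ▸ hb0 h.1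
      simpa only [pullback_smul, zero_mul, h0] using (hcm m).const_smul 0
    · obtain ⟨g, hg, κ, hκ, hgκ⟩ := exists_mem_projAlgebra_hasLeadingCoeffAt hN ha n j
        fun hn hd => by
          have := Int.le_of_dvd (by omega) hd
          have := Finset.mem_range.1 hj
          omega
      refine ⟨(b j / κ) • g, Subalgebra.smul_mem _ hg _, fun m => ?_⟩
      rw [pullback_smul]
      convert! (hgκ m).const_smul (b j / κ) using 1
      rw [← mul_assoc, div_mul_cancel₀ _ hκ]
  choose! g hgA hgc using hg
  refine ⟨∑ j ∈ Finset.range N, g j, sum_mem hgA, fun p hp => ?_⟩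
  obtain ⟨m, hm⟩ := mk_mem_orbit_iff.1 hp
  rw [(hc p hp).unique ((hcm m).pullback_of_mk_eq hm), show c (m * a) = _ from hb m]
  refine HasLeadingCoeffAt.pullback_of_mk_eq ?_ hm
  rw [pullback_sum]
  exact HasLeadingCoeffAt.sum _ fun j hj => hgc j hj m

/-! ### Descent of `P_{-j} P_j` to `T'` -/

theorem exists_descent_projP_mul_projP (hN : 3 ≤ N)
    (ha : addOrderOf (Submodule.Quotient.mk a : L.Torus) = N) {L' : PeriodPair}
    (hL' : L'.lattice = L.torsionLattice (Submodule.Quotient.mk a)) {j : ℤ}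
    (hj : ¬ (N : ℤ) ∣ j) :
    ∃ Q ∈ L'.evenRegularFunctions {0},
      Q ∘ L.puncturedProj hL' =
        L.projP N (Submodule.Quotient.mk a) (-j) * L.projP N (Submodule.Quotient.mk a) j ∧
      ∃ d ≠ 0, HasLeadingCoeffAt (L'.pullback Q) 2 0 d := by
  have hN0 : N ≠ 0 := by omega
  set f := L.projP N (Submodule.Quotient.mk a) (-j) * L.projP N (Submodule.Quotient.mk a) j with hf
  have hfreg : f ∈ L.regularFunctions (L.orbit (Submodule.Quotient.mk a)) :=
    mul_mem (projP_mem_regularFunctions (by omega) ha _)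
      (projP_mem_regularFunctions (by omega) ha _)
  obtain ⟨hm, han⟩ := (mem_regularFunctions_iff (finite_orbit hN0 ha)).1 hfreg
  have hmem : ∀ z, (Submodule.Quotient.mk z : L'.Torus) ∈ ({0} : Set L'.Torus) ↔
      (Submodule.Quotient.mk z : L.Torus) ∈ L.orbit (Submodule.Quotient.mk a) := fun z => by
    rw [mk_mem_singleton_zero_iff, hL', mem_torsionLattice_iff]
  have hcongr : ∀ z w, ((Submodule.Quotient.mk z : L.Torus) ∈ L.orbit (Submodule.Quotient.mk a) ↔
      (Submodule.Quotient.mk w : L.Torus) ∈ L.orbit (Submodule.Quotient.mk a)) →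
      L.projMeromorphic N a (-j) z * L.projMeromorphic N a j z =
        L.projMeromorphic N a (-j) w * L.projMeromorphic N a j w →
      L.pullback f z = L.pullback f w := fun z w h1 h2 => by
    by_cases h : (Submodule.Quotient.mk w : L.Torus) ∈ L.orbit (Submodule.Quotient.mk a)
    · rw [pullback_of_mem f h, pullback_of_mem f (h1.2 h)]
    · rw [pullback_of_notMem f h, pullback_of_notMem f (mt h1.1 h), hf, Pi.mul_apply, Pi.mul_apply,
        projP_mk, projP_mk, projP_mk, projP_mk, h2]
  -- The factors `ω^(mj)` and `ω^(-mj)` picked up under translation by `ma` cancel.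
  have hma : ∀ (m : ℤ) z, L.pullback f (z + m * a) = L.pullback f z := fun m z => by
    refine hcongr _ _ (mk_add_mul_mem_orbit_iff m) ?_
    rw [projMeromorphic_add hN0 ha, projMeromorphic_add hN0 ha, mul_mul_mul_comm,
      ← zpow_add₀ (rootOfUnity_ne_zero N)]
    simp
  have hneg : ∀ z, L.pullback f (-z) = L.pullback f z := fun z => by
    refine hcongr _ _ ?_ ?_
    · rw [Submodule.Quotient.mk_neg]
      exact AddSubgroup.neg_mem_iff _
    · rw [projMeromorphic_neg hN0 ha, projMeromorphic_neg hN0 ha, neg_neg]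
      ring
  have hper : ∀ z w : ℂ, (Submodule.Quotient.mk z : L'.Torus) = Submodule.Quotient.mk w →
      L.pullback f z = L.pullback f w := fun z w h => by
    have h1 := (Submodule.Quotient.eq _).1 h
    rw [hL', mem_torsionLattice_iff, mk_mem_orbit_iff] at h1
    obtain ⟨m, h2⟩ := h1
    have h3 := pullback_add_of_mem_lattice f ((Submodule.Quotient.eq _).1 h2) (w + m * a)
    rw [show w + m * a + (z - w - m * a) = z by ring] at h3
    rw [h3, hma]
  -- An arbitrary lift to `ℂ` serves, since `hper` makes the value independent of it.
  set Q : L'.Punctured {0} → ℂ := fun y =>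
    L.pullback f (Function.surjInv (Submodule.Quotient.mk_surjective L'.lattice) y.1)
  have hQ : ∀ (z : ℂ) (hz : (Submodule.Quotient.mk z : L'.Torus) ∉ ({0} : Set L'.Torus)),
      Q ⟨Submodule.Quotient.mk z, hz⟩ = L.pullback f z := fun z hz =>
    hper _ _ (Function.surjInv_eq (Submodule.Quotient.mk_surjective L'.lattice) _)
  refine ⟨Q, ⟨⟨L.pullback f, hm, fun z hz => ⟨han z (by rwa [← hmem]), (hQ z hz).symm⟩⟩, ?_⟩, ?_,
    projResidue N j * projResidue N j,
    mul_ne_zero (projResidue_ne_zero hN0 hj) (projResidue_ne_zero hN0 hj), ?_⟩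
  · intro x hx hx'
    obtain ⟨z, rfl⟩ := Submodule.Quotient.mk_surjective _ x
    rw [hQ z hx, ← hneg, ← hQ (-z) (by simpa using hx)]
    rfl
  · funext x
    obtain ⟨x, hx⟩ := x
    obtain ⟨z, rfl⟩ := Submodule.Quotient.mk_surjective _ x
    rw [← pullback_of_notMem f hx]
    exact hQ z (by rwa [hmem])
  · refine HasLeadingCoeffAt.congr (F := L.pullback f) ?_ ?_
    · rw [hf, pullback_mul]
      have h := (hasLeadingCoeffAt_projP hN ha (-j) 0).mul (hasLeadingCoeffAt_projP hN ha j 0)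
      simpa [projResidue_neg] using h
    · filter_upwards [L'.eventually_nhdsNE_mk_notMem (Set.finite_singleton 0) 0] with z hz
      rw [pullback_of_notMem _ hz, hQ]

end

end PeriodPair

end

theorem mainTheorem11 (L : PeriodPair) (N : ℕ) (hN : 3 ≤ N) (α : L.Torus)
    (hα : addOrderOf α = N) :
    Algebra.adjoin ℂ {f | ∃ j : ℤ, 1 ≤ j ∧ j ≤ (N : ℤ) - 1 ∧ f = L.projP N α j} =
        L.regularFunctions (L.orbit α) ∧
      ∀ (L' : PeriodPair) (hL' : L'.lattice = L.torsionLattice α) (j : ℤ), ¬ j ≡ 0 [ZMOD N] →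
        Algebra.adjoin ℂ {L'.puncturedP ∘ L.puncturedProj hL'} =
            Algebra.adjoin ℂ {L.projP N α (-j) * L.projP N α j} ∧
          ∃ Q : L'.Punctured {0} → ℂ,
            Q ∘ L.puncturedProj hL' = L.projP N α (-j) * L.projP N α j ∧
              Algebra.adjoin ℂ {L'.puncturedP} = Algebra.adjoin ℂ {Q} ∧
              Algebra.adjoin ℂ {Q} = L'.evenRegularFunctions {0} := by
  obtain ⟨a, rfl⟩ := Submodule.Quotient.mk_surjective _ α
  refine ⟨PeriodPair.projAlgebra_eq_regularFunctions hN hα, fun L' hL' j hj => ?_⟩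
  obtain ⟨Q, hQ, hQf, d, hd, hQd⟩ := PeriodPair.exists_descent_projP_mul_projP hN hα hL'
    fun h => hj ((Int.modEq_zero_iff_dvd).2 h)
  have h1 := PeriodPair.adjoin_eq_evenRegularFunctions hQ hd hQd
  have h2 := PeriodPair.adjoin_eq_evenRegularFunctions L'.puncturedP_mem_evenRegularFunctions
    one_ne_zero L'.hasLeadingCoeffAt_puncturedP
  refine ⟨?_, Q, hQf, h2.trans h1.symm, h1⟩
  -- The equality on `T` is the image of the one on `T'` under pull-back along the projection.
  let φ : (L'.Punctured {0} → ℂ) →ₐ[ℂ]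
      (L.Punctured (L.orbit (Submodule.Quotient.mk a)) → ℂ) :=
    { toFun := fun h => h ∘ L.puncturedProj hL'
      map_one' := rfl
      map_mul' := fun _ _ => rfl
      map_zero' := rfl
      map_add' := fun _ _ => rfl
      commutes' := fun _ => rfl }
  have h3 := congrArg (Subalgebra.map φ) (h2.trans h1.symm)
  rw [AlgHom.map_adjoin_singleton, AlgHom.map_adjoin_singleton] at h3
  rw [← hQf]
  exact h3
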